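/- All graphs are finite, simple and undirected; $n=|V(G)|$, and $d(v)$ and $N(v)$ denote the degree and the neighbourhood of $v$ in $G$. **Definitions.** A graph is *2-connected* if it has at least three vertices, is connected, and remains connected after deletion of any one vertex. Two distinct nonadjacent vertices $u,v$ of $G$ form an *$o$-heavy pair* of $G$ if $d(u)+d(v)\ge n$; two adjacent vertices $u,v$ form an *$a$-heavy pair* of $G$ if $d(u)+d(v)\ge n$. For a graph $H$, $G$ is *$H$-$o$-heavy* if every induced subgraph of $G$ isomorphic to $H$ contains an $o$-heavy pair of $G$, and $G$ is *$\{R,S\}$-$o$-heavy* if it is both $R$-$o$-heavy and $S$-$o$-heavy. $G$ is *claw-free* if it has no induced subgraph isomorphic to $K_{1,3}$. $P_k$ is the path and $C_k$ the cycle on $k$ vertices; $Z_k$ is obtained by identifying a vertex of a triangle with an end-vertex of a path $P_{k+1}$; the *bull* $B$ (respectively the *net* $N$) is a triangle with one pendant edge attached at each of two (respectively three) of its vertices. $G$ is *$N$-$p$-heavy* if in every induced net of $G$ the triangle contains an $a$-heavy pair of $G$. For $x\in V(G)$ let $G^{BC}_x$ be obtained from $G$ by adding all edges $uv$ with $u,v\in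 N(x)$ such that $\{u,v\}$ is an $o$-heavy pair of $G$. The vertex $x$ is *$c$-eligible* in $G$ if $N(x)$ is not a clique in $G$ and either (i) $G^{BC}_x[N(x)]$ is connected, or (ii) $G^{BC}_x[N(x)]$ is the disjoint union of two cliques $C_1$ and $C_2$, and there is an $o$-heavy pair $\{x,z\}$ of $G$ with $zy_1,zy_2\in E(G)$ for some $y_1\in C_1$ and $y_2\in C_2$. The *local $c$-completion* of $G$ at $x$ is obtained from $G$ by adding all edges between nonadjacent vertices of $N(x)$. A *$c$-closure* of a $K_{1,3}$-$o$-heavy graph $G$, denoted $\mathrm{cl}_c(G)$, is any graph obtained from $G$ by repeatedly performing local $c$-completions at $c$-eligible vertices of the current graph until there are no $c$-eligible vertices left. **Theorem.** Let $G$ be a 2-connected $\{K_{1,3},S\}$-$o$-heavy graph, where $S\in\{P_4,P_5,C_3,Z_1,Z_2,B,N\}$. Then $\mathrm{cl}_c(G)$ (whatever the choices made in forming it) is claw-free and $N$-$p$-heavy. -/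

import Mathlib

namespace CClosure

variable {V : Type*} {W : Type*}

/-! ### The special graphs -/

/-- The claw `K_{1,3}`. -/
abbrev claw : SimpleGraph (Fin 1 ⊕ Fin 3) := completeBipartiteGraph (Fin 1) (Fin 3)

/-- `Z_1`: a triangle `0 1 2` with the pendant edge `2 3`. -/
def Z₁ : SimpleGraph (Fin 4) :=
  SimpleGraph.fromEdgeSet {s(0, 1), s(0, 2), s(1, 2), s(2, 3)}

/-- `Z_2`: a triangle `0 1 2` with the path `2 3 4` attached at `2`. -/
def Z₂ : SimpleGraph (Fin 5) :=
  SimpleGraph.fromEdgeSet {s(0, 1), s(0, 2), s(1, 2), s(2, 3), s(3, 4)}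

/-- The bull: a triangle `0 1 2` with the pendant edges `0 3` and `1 4`. -/
def bull : SimpleGraph (Fin 5) :=
  SimpleGraph.fromEdgeSet {s(0, 1), s(0, 2), s(1, 2), s(0, 3), s(1, 4)}

/-- The net: a triangle `0 1 2` with the pendant edges `0 3`, `1 4` and `2 5`. -/
def net : SimpleGraph (Fin 6) :=
  SimpleGraph.fromEdgeSet {s(0, 1), s(0, 2), s(1, 2), s(0, 3), s(1, 4), s(2, 5)}

/-! ### Connectivity and heavy pairs -/

/-- `G` is 2-connected: at least three vertices, connected, and no cut vertex. -/
def IsTwoConnected [Fintype V] (G : SimpleGraph V) : Prop :=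
  3 ≤ Fintype.card V ∧ G.Connected ∧ ∀ v : V, (G.induce {v}ᶜ).Connected

open Classical in
/-- The degree sum of `u` and `v` in `G` is at least the number of vertices. -/
def LargeDegreeSum [Fintype V] (G : SimpleGraph V) (u v : V) : Prop :=
  Fintype.card V ≤ G.degree u + G.degree v

/-- `{u, v}` is an `o`-heavy pair of `G`: two distinct nonadjacent vertices with degree sum
at least the number of vertices. -/
def OHeavyPair [Fintype V] (G : SimpleGraph V) (u v : V) : Prop :=
  u ≠ v ∧ ¬ G.Adj u v ∧ LargeDegreeSum G u v

/-- `{u, v}` is an `a`-heavy pair of `G`: two adjacent vertices with degree sum at least the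
number of vertices. -/
def AHeavyPair [Fintype V] (G : SimpleGraph V) (u v : V) : Prop :=
  G.Adj u v ∧ LargeDegreeSum G u v

/-- `G` is `H`-`o`-heavy: every induced subgraph of `G` isomorphic to `H` (that is, the range
of an embedding of `H` as an induced subgraph) contains an `o`-heavy pair of `G`. -/
def OHeavy [Fintype V] (H : SimpleGraph W) (G : SimpleGraph V) : Prop :=
  ∀ f : H ↪g G, ∃ i j : W, OHeavyPair G (f i) (f j)

/-- `G` is `N`-`p`-heavy: the triangle of every induced net of `G` contains an
`a`-heavy pair of `G`. -/
def NPHeavy [Fintype V] (G : SimpleGraph V) : Prop :=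
  ∀ f : net ↪g G, ∃ i ∈ ({0, 1, 2} : Set (Fin 6)), ∃ j ∈ ({0, 1, 2} : Set (Fin 6)),
    AHeavyPair G (f i) (f j)

/-- `G` is claw-free: it has no induced subgraph isomorphic to `K_{1,3}`. -/
def ClawFree (G : SimpleGraph V) : Prop :=
  ¬ claw.IsIndContained G

/-! ### The `c`-closure -/

/-- The graph `G^{BC}_x`: all pairs of nonadjacent neighbours of `x` with degree sum (in `G`)
at least the number of vertices are joined. -/
def bcGraph [Fintype V] (G : SimpleGraph V) (x : V) : SimpleGraph V where
  Adj u v := G.Adj u v ∨ (G.Adj x u ∧ G.Adj x v ∧ OHeavyPair G u v)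
  symm := ⟨by
    rintro u v (h | ⟨hu, hv, hne, hn, hd⟩)
    · exact Or.inl h.symm
    · refine Or.inr ⟨hv, hu, hne.symm, fun h => hn h.symm, ?_⟩
      unfold LargeDegreeSum at hd ⊢
      omega⟩
  loopless := ⟨by
    rintro u (h | ⟨_, _, hne, _⟩)
    · exact G.loopless.irrefl u h
    · exact hne rfl⟩

/-- `x` is a `c`-eligible vertex of `G`: its neighbourhood `N(x)` is not a clique of `G`, and
either `G^{BC}_x[N(x)]` is connected, or it is the disjoint union of two cliques `C₁`, `C₂` and
there is an `o`-heavy pair `{x, z}` such that `z` has a neighbour in `C₁` and one in `C₂`. -/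
def CEligible [Fintype V] (G : SimpleGraph V) (x : V) : Prop :=
  ¬ G.IsClique (G.neighborSet x) ∧
    (((bcGraph G x).induce (G.neighborSet x)).Connected ∨
      ∃ C₁ C₂ : Set V,
        C₁ ∪ C₂ = G.neighborSet x ∧ Disjoint C₁ C₂ ∧
        (bcGraph G x).IsClique C₁ ∧ (bcGraph G x).IsClique C₂ ∧
        (∀ u ∈ C₁, ∀ v ∈ C₂, ¬ (bcGraph G x).Adj u v) ∧
        ∃ z : V, OHeavyPair G x z ∧ (∃ y₁ ∈ C₁, G.Adj z y₁) ∧ (∃ y₂ ∈ C₂, G.Adj z y₂))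

/-- The local `c`-completion `G^o_x`: the neighbourhood of `x` is made a clique. -/
def localCompletion (G : SimpleGraph V) (x : V) : SimpleGraph V where
  Adj u v := G.Adj u v ∨ (G.Adj x u ∧ G.Adj x v ∧ u ≠ v)
  symm := ⟨by
    rintro u v (h | ⟨hu, hv, hne⟩)
    · exact Or.inl h.symm
    · exact Or.inr ⟨hv, hu, hne.symm⟩⟩
  loopless := ⟨by
    rintro u (h | ⟨_, _, hne⟩)
    · exact G.loopless.irrefl u h
    · exact hne rfl⟩

/-- One step of the closure: a local `c`-completion at a `c`-eligible vertex. -/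
def CStep [Fintype V] (G G' : SimpleGraph V) : Prop :=
  ∃ x : V, CEligible G x ∧ G' = localCompletion G x

/-- `G'` is a `c`-closure of `G`: it arises from `G` by finitely many local `c`-completions at
`c`-eligible vertices, and it has no `c`-eligible vertex. -/
def IsCClosure [Fintype V] (G G' : SimpleGraph V) : Prop :=
  Relation.ReflTransGen CStep G G' ∧ ∀ x : V, ¬ CEligible G' x

theorem CStep.lt [Fintype V] {G G' : SimpleGraph V} (h : CStep G G') : G < G' := by
  obtain ⟨x, ⟨hx, -⟩, rfl⟩ := h
  refine lt_of_le_not_ge (fun u v h => Or.inl h) fun hle => hx ?_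
  intro u hu v hv huv
  exact hle (Or.inr ⟨hu, hv, huv⟩)

/-- Every finite graph has a `c`-closure. -/
theorem exists_isCClosure [Fintype V] (G : SimpleGraph V) : ∃ G', IsCClosure G G' := by
  induction G using WellFoundedGT.induction with
  | ind G ih =>
    by_cases h : ∃ x, CEligible G x
    · obtain ⟨x, hx⟩ := h
      have hs : CStep G (localCompletion G x) := ⟨x, hx, rfl⟩
      obtain ⟨G', hG', hc⟩ := ih _ hs.lt
      exact ⟨G', Relation.ReflTransGen.head hs hG', hc⟩
    · exact ⟨G, Relation.ReflTransGen.refl, fun x hx => h ⟨x, hx⟩⟩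

end CClosure

namespace CClosure

/-! ### Degree sums -/

section Counting

variable {V : Type*} [Fintype V] {G G' : SimpleGraph V} {u v w : V}

/-! Local completion preserves `K_{1,3}`-`o`-heaviness, and a `K_{1,3}`-`o`-heavy graph without
`c`-eligible vertices has no `o`-heavy pair at all (`not_oHeavyPair_of_closed`). Hence the closure
`G'` is claw-free, and each of its neighbourhoods is a clique or two cliques with no edge between
them, so every edge of `G'` lies in just one maximal clique (`line`). Moreover the ends of an edge
of `G'` are joined in `G` by a walk whose inner vertices are simplicial in `G'`
(`linked_of_reflTransGen`). `ClosedOver` collects these facts; nothing else about the closure is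
used.

Degrees only grow, so a pair nonadjacent in `G'` is light in `G`. When a forbidden induced subgraph
is built in `G`, only pairs that are adjacent in `G'` but not in `G` need attention.

Suppose the triangle `a b c` of a net of `G'` has no `a`-heavy pair. The pendant edges can be chosen
in `G`, and a triangle edge missing from `G` would be replaced by an induced link that yields a
light net, `P₅` and `Z₂` (`IsNet.adj_of_not_large`). So the net lies in `G`, which settles `N` and
its induced subgraphs `P₄`, `C₃`, `Z₁`, `B`.

For `P₅` and `Z₂`, consider the cliques of `G'` on the pendant edges. One of any two of them has no
pair with large degree sum (`IsNet.not_large_of_large`), and by 2-connectedness an edge of `G`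
leaves that clique away from its corner. Following this edge gives a light `P₅` or `Z₂`; the one
stubborn case, a `Z₂` whose exit meets another corner's clique, falls to a degree count
(`ClosedOver.false_of_exit_Z₂`). -/

theorem largeDegreeSum_iff :
    LargeDegreeSum G u v ↔
      Fintype.card V ≤ (G.neighborSet u).ncard + (G.neighborSet v).ncard := by
  classical
  unfold LargeDegreeSum
  rw [Set.ncard_eq_toFinset_card', Set.ncard_eq_toFinset_card']
  simp only [SimpleGraph.degree, SimpleGraph.neighborFinset]

theorem LargeDegreeSum.symm (h : LargeDegreeSum G u v) : LargeDegreeSum G v u := by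
  unfold LargeDegreeSum at *
  omega

theorem LargeDegreeSum.of_ncard_le {x y : V} (h : LargeDegreeSum G u v)
    (hx : (G.neighborSet u).ncard ≤ (G'.neighborSet x).ncard)
    (hy : (G.neighborSet v).ncard ≤ (G'.neighborSet y).ncard) : LargeDegreeSum G' x y := by
  rw [largeDegreeSum_iff] at *
  omega

theorem ncard_neighborSet_mono (h : G ≤ G') (u : V) :
    (G.neighborSet u).ncard ≤ (G'.neighborSet u).ncard :=
  Set.ncard_le_ncard (fun _ hv => h hv) (Set.toFinite _)

theorem LargeDegreeSum.mono (h : G ≤ G') (hL : LargeDegreeSum G u v) : LargeDegreeSum G' u v :=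
  hL.of_ncard_le (ncard_neighborSet_mono h u) (ncard_neighborSet_mono h v)

theorem ncard_add_ncard_le_of_disjoint (h : ∀ y, G.Adj u y → ¬ G.Adj v y) :
    (G.neighborSet u).ncard + (G.neighborSet v).ncard ≤ Fintype.card V := by
  have hd : Disjoint (G.neighborSet u) (G.neighborSet v) :=
    Set.disjoint_left.2 fun y hu hv => h y hu hv
  rw [← Set.ncard_union_eq hd, ← Nat.card_eq_fintype_card, ← Set.ncard_univ]
  exact Set.ncard_le_ncard (Set.subset_univ _)

theorem ncard_add_ncard_lt_of_disjoint (h : ∀ y, G.Adj u y → ¬ G.Adj v y)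
    (hu : ¬ G.Adj u w) (hv : ¬ G.Adj v w) :
    (G.neighborSet u).ncard + (G.neighborSet v).ncard < Fintype.card V := by
  have hd : Disjoint (G.neighborSet u) (G.neighborSet v) :=
    Set.disjoint_left.2 fun y hu hv => h y hu hv
  rw [← Set.ncard_union_eq hd, ← Nat.card_eq_fintype_card, ← Set.ncard_univ]
  refine Set.ncard_lt_ncard ((Set.ssubset_univ_iff).2 fun he => ?_)
  have : w ∈ G.neighborSet u ∪ G.neighborSet v := he ▸ Set.mem_univ w
  exact this.elim hu hv

/-- The common neighbours of an `o`-heavy pair outnumber the other vertices missed by both. -/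
theorem OHeavyPair.ncard_lt (h : OHeavyPair G u v) {T : Set V}
    (hT : ∀ t ∈ T, t ≠ u ∧ t ≠ v ∧ ¬ G.Adj u t ∧ ¬ G.Adj v t) :
    T.ncard + 1 < (G.neighborSet u ∩ G.neighborSet v).ncard := by
  obtain ⟨hne, hn, hL⟩ := h
  rw [largeDegreeSum_iff] at hL
  have h1 := Set.ncard_union_add_ncard_inter (G.neighborSet u) (G.neighborSet v)
  have h2 : (T ∪ {u, v}).ncard = T.ncard + 2 := by
    rw [Set.ncard_union_eq, Set.ncard_pair hne]
    refine Set.disjoint_left.2 fun t ht h => ?_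
    rcases h with rfl | rfl
    · exact (hT _ ht).1 rfl
    · exact (hT _ ht).2.1 rfl
  have h3 : Disjoint (G.neighborSet u ∪ G.neighborSet v) (T ∪ {u, v}) := by
    refine Set.disjoint_left.2 fun t ht h => ?_
    rcases h with h | rfl | rfl
    · exact ht.elim (hT _ h).2.2.1 (hT _ h).2.2.2
    · exact ht.elim (fun h => h.ne rfl) (fun h => hn h.symm)
    · exact ht.elim (fun h => hn h) (fun h => h.ne rfl)
  have h4 := Set.ncard_le_ncard (Set.subset_univ
    ((G.neighborSet u ∪ G.neighborSet v) ∪ (T ∪ {u, v}))) (Set.toFinite _)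
  rw [Set.ncard_union_eq h3, Set.ncard_univ, Nat.card_eq_fintype_card] at h4
  omega

/-- Neither vertex of the pair is in either neighbourhood, so a degree sum of `n` forces two common
neighbours. -/
theorem OHeavyPair.exists_common_ne (h : OHeavyPair G u v) (x : V) :
    ∃ p, p ≠ x ∧ G.Adj u p ∧ G.Adj v p := by
  have := h.ncard_lt (T := ∅) (by simp)
  obtain ⟨p, hp, hpx⟩ := Set.exists_ne_of_one_lt_ncard (by simpa using this) x
  exact ⟨p, hpx, hp.1, hp.2⟩

end Counting

/-! ### Induced claws -/

section Claw

variable {V : Type*} {G G' : SimpleGraph V}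

/-- The embedding of the claw given by a vertex and three pairwise nonadjacent neighbours. -/
theorem exists_claw_embedding {x p q r : V} (hp : G.Adj x p) (hq : G.Adj x q) (hr : G.Adj x r)
    (hpq : p ≠ q) (hpr : p ≠ r) (hqr : q ≠ r)
    (npq : ¬ G.Adj p q) (npr : ¬ G.Adj p r) (nqr : ¬ G.Adj q r) :
    ∃ f : claw ↪g G, (∀ i, f (Sum.inl i) = x) ∧ ∀ i, f (Sum.inr i) = ![p, q, r] i := by
  refine ⟨⟨⟨Sum.elim (fun _ => x) ![p, q, r], ?_⟩, ?_⟩, fun _ => rfl, fun _ => rfl⟩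
  · rintro (i | i) (j | j) h <;> fin_cases i <;> fin_cases j <;>
      simp_all [hp.ne, hq.ne, hr.ne, hp.ne', hq.ne', hr.ne', hpq.symm, hpr.symm, hqr.symm]
  · intro i j
    change G.Adj (Sum.elim (fun _ => x) ![p, q, r] i) (Sum.elim (fun _ => x) ![p, q, r] j) ↔
      claw.Adj i j
    rcases i with i | i <;> rcases j with j | j <;> fin_cases i <;> fin_cases j <;>
      simp_all [G.adj_comm _ x, G.adj_comm q p, G.adj_comm r p, G.adj_comm r q]

variable [Fintype V]

theorem oHeavy_claw_iff : OHeavy claw G ↔ ∀ x p q r, G.Adj x p → G.Adj x q → G.Adj x r →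
    p ≠ q → p ≠ r → q ≠ r → ¬ G.Adj p q → ¬ G.Adj p r → ¬ G.Adj q r →
    LargeDegreeSum G p q ∨ LargeDegreeSum G p r ∨ LargeDegreeSum G q r := by
  constructor
  · intro h x p q r hp hq hr hpq hpr hqr npq npr nqr
    obtain ⟨f, hf, hf'⟩ := exists_claw_embedding hp hq hr hpq hpr hqr npq npr nqr
    obtain ⟨i, j, hij⟩ := h f
    obtain ⟨hne, hn, hL⟩ := hij
    rcases i with i | i <;> rcases j with j | j <;> fin_cases i <;> fin_cases j <;>
      simp_all [SimpleGraph.adj_comm] <;>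
      first
        | exact Or.inl hL.symm
        | exact Or.inr (Or.inl hL.symm)
        | exact Or.inr (Or.inr hL.symm)
  · intro h f
    have hadj : ∀ i, G.Adj (f (Sum.inl 0)) (f (Sum.inr i)) := fun i => by
      rw [f.map_adj_iff]; simp
    have hnadj : ∀ i j, ¬ G.Adj (f (Sum.inr i)) (f (Sum.inr j)) := fun i j => by
      rw [f.map_adj_iff]; simp
    have hne : ∀ i j : Fin 3, i ≠ j → f (Sum.inr i) ≠ f (Sum.inr j) := fun i j hij he =>
      hij (Sum.inr_injective (f.injective he))
    have h01 := hne 0 1 (by decide)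
    have h02 := hne 0 2 (by decide)
    have h12 := hne 1 2 (by decide)
    rcases h _ _ _ _ (hadj 0) (hadj 1) (hadj 2) h01 h02 h12 (hnadj _ _) (hnadj _ _)
      (hnadj _ _) with h | h | h
    · exact ⟨_, _, h01, hnadj _ _, h⟩
    · exact ⟨_, _, h02, hnadj _ _, h⟩
    · exact ⟨_, _, h12, hnadj _ _, h⟩

/-- Local completion preserves being `K_{1,3}`-`o`-heavy. -/
theorem OHeavy.localCompletion (h : OHeavy claw G) (x : V) :
    OHeavy claw (localCompletion G x) := by
  rw [oHeavy_claw_iff] at *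
  have hle : G ≤ CClosure.localCompletion G x := fun _ _ h => Or.inl h
  -- Case of a claw with a new edge `c p`: then `q` and `r` lie outside `N(x)`, so `x, q, r` are the
  -- leaves of a claw of `G` at `c`. In a large pair `p` can replace `x`, since its new degree is at
  -- least the old degree of `x`.
  have key : ∀ c p q r, G.Adj x c → G.Adj x p → c ≠ p →
      (CClosure.localCompletion G x).Adj c q → (CClosure.localCompletion G x).Adj c r →
      p ≠ q → p ≠ r → q ≠ r → ¬ (CClosure.localCompletion G x).Adj p q →
      ¬ (CClosure.localCompletion G x).Adj p r → ¬ (CClosure.localCompletion G x).Adj q r →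
      LargeDegreeSum (CClosure.localCompletion G x) p q ∨
      LargeDegreeSum (CClosure.localCompletion G x) p r ∨
      LargeDegreeSum (CClosure.localCompletion G x) q r := by
    intro c p q r hc hp hcp hcq hcr hpq hpr hqr npq npr nqr
    have hxq : ¬ G.Adj x q := fun h => npq (Or.inr ⟨hp, h, hpq⟩)
    have hxr : ¬ G.Adj x r := fun h => npr (Or.inr ⟨hp, h, hpr⟩)
    have hcq' : G.Adj c q := hcq.resolve_right fun h => hxq h.2.1
    have hcr' : G.Adj c r := hcr.resolve_right fun h => hxr h.2.1
    have hx_q : x ≠ q := by rintro rfl; exact npq (Or.inl hp.symm)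
    have hx_r : x ≠ r := by rintro rfl; exact npr (Or.inl hp.symm)
    have hdeg : (G.neighborSet x).ncard ≤
        ((CClosure.localCompletion G x).neighborSet p).ncard := by
      have h1 : insert x (G.neighborSet x \ {p}) ⊆
          (CClosure.localCompletion G x).neighborSet p := by
        rintro y (rfl | ⟨hy, hyp⟩)
        · exact Or.inl hp.symm
        · exact Or.inr ⟨hp, hy, fun h => hyp h.symm⟩
      have h2 := Set.ncard_le_ncard h1 (Set.toFinite _)
      rw [Set.ncard_insert_of_notMem (fun h => h.1.ne rfl) (Set.toFinite _)] at h2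
      have h3 := Set.ncard_sdiff_singleton_add_one (a := p) (s := G.neighborSet x) hp
        (Set.toFinite _)
      omega
    rcases h c x q r hc.symm hcq' hcr' hx_q hx_r hqr hxq hxr (fun h => nqr (Or.inl h))
      with h | h | h
    · exact Or.inl (h.of_ncard_le hdeg (ncard_neighborSet_mono hle _))
    · exact Or.inr (Or.inl (h.of_ncard_le hdeg (ncard_neighborSet_mono hle _)))
    · exact Or.inr (Or.inr (h.mono hle))
  intro c p q r hp hq hr hpq hpr hqr npq npr nqr
  rcases id hp with hp' | ⟨h1, h2, h3⟩
  · rcases id hq with hq' | ⟨h1, h2, h3⟩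
    · rcases id hr with hr' | ⟨h1, h2, h3⟩
      · rcases h c p q r hp' hq' hr' hpq hpr hqr (fun h => npq (hle h)) (fun h => npr (hle h))
          (fun h => nqr (hle h)) with h | h | h
        · exact Or.inl (h.mono hle)
        · exact Or.inr (Or.inl (h.mono hle))
        · exact Or.inr (Or.inr (h.mono hle))
      · rcases key c r p q h1 h2 h3 hp hq hpr.symm hqr.symm hpq (fun h => npr h.symm)
          (fun h => nqr h.symm) npq with h | h | h
        · exact Or.inr (Or.inl h.symm)
        · exact Or.inr (Or.inr h.symm)
        · exact Or.inl h
    · rcases key c q p r h1 h2 h3 hp hr hpq.symm hqr hpr (fun h => npq h.symm) nqr npr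
        with h | h | h
      · exact Or.inl h.symm
      · exact Or.inr (Or.inr h)
      · exact Or.inr (Or.inl h)
  · exact key c p q r h1 h2 h3 hq hr hpq hpr hqr npq npr nqr

end Claw

/-! ### Graphs without `c`-eligible vertices -/

section Closed

variable {V : Type*} [Fintype V] {G : SimpleGraph V} {x : V}

theorem bcGraph_large {p q : V} (h : ¬ (bcGraph G x).Adj p q) (hp : G.Adj x p) (hq : G.Adj x q)
    (hne : p ≠ q) : ¬ G.Adj p q ∧ ¬ LargeDegreeSum G p q := by
  have hn : ¬ G.Adj p q := fun h' => h (Or.inl h')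
  exact ⟨hn, fun hL => h (Or.inr ⟨hp, hq, hne, hn, hL⟩)⟩

/-- In a `K_{1,3}`-`o`-heavy graph the neighbourhood of a vertex that is not `c`-eligible is a
clique, or it splits into two cliques of `G^{BC}_x` that no `o`-heavy pair `{x, z}` links. -/
theorem exists_cliques_of_not_cEligible (hclaw : OHeavy claw G) (hx : ¬ CEligible G x)
    (hK : ¬ G.IsClique (G.neighborSet x)) :
    ∃ C₁ C₂ : Set V, C₁.Nonempty ∧ C₂.Nonempty ∧ C₁ ∪ C₂ = G.neighborSet x ∧
      (bcGraph G x).IsClique C₁ ∧ (bcGraph G x).IsClique C₂ ∧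
      (∀ u ∈ C₁, ∀ v ∈ C₂, ¬ (bcGraph G x).Adj u v) ∧
      ∀ z y₁ y₂ : V, OHeavyPair G x z → y₁ ∈ C₁ → y₂ ∈ C₂ → G.Adj z y₁ → ¬ G.Adj z y₂ := by
  rw [oHeavy_claw_iff] at hclaw
  -- No three neighbours of `x` are independent in `bcGraph`. Once it is disconnected on `N(x)`, a
  -- component and its complement are therefore both cliques: compare two vertices of one with a
  -- vertex of the other.
  have hind : ∀ p q r, G.Adj x p → G.Adj x q → G.Adj x r → p ≠ q → p ≠ r → q ≠ r →
      (bcGraph G x).Adj p q ∨ (bcGraph G x).Adj p r ∨ (bcGraph G x).Adj q r := by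
    intro p q r hp hq hr hpq hpr hqr
    by_contra! hcon
    obtain ⟨h1, h2, h3⟩ := hcon
    obtain ⟨n1, l1⟩ := bcGraph_large h1 hp hq hpq
    obtain ⟨n2, l2⟩ := bcGraph_large h2 hp hr hpr
    obtain ⟨n3, l3⟩ := bcGraph_large h3 hq hr hqr
    rcases hclaw x p q r hp hq hr hpq hpr hqr n1 n2 n3 with h | h | h
    exacts [l1 h, l2 h, l3 h]
  have hconn : ¬ ((bcGraph G x).induce (G.neighborSet x)).Connected := fun h => hx ⟨hK, Or.inl h⟩
  have hne : (G.neighborSet x).Nonempty := by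
    by_contra h
    rw [Set.not_nonempty_iff_eq_empty] at h
    exact hK (h ▸ Set.pairwise_empty _)
  obtain ⟨u, v, huv⟩ : ∃ u v : G.neighborSet x,
      ¬ ((bcGraph G x).induce (G.neighborSet x)).Reachable u v := by
    by_contra! h
    have : Nonempty (G.neighborSet x) := hne.to_subtype
    exact hconn ⟨h⟩
  let C₁ : Set V := {w | ∃ hw : w ∈ G.neighborSet x,
    ((bcGraph G x).induce (G.neighborSet x)).Reachable u ⟨w, hw⟩}
  let C₂ : Set V := G.neighborSet x \ C₁
  have hcross : ∀ p ∈ C₁, ∀ q ∈ C₂, ¬ (bcGraph G x).Adj p q := by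
    rintro p ⟨hp, hup⟩ q ⟨hq, hq'⟩ hpq
    refine hq' ⟨hq, hup.trans (SimpleGraph.Adj.reachable ?_)⟩
    exact hpq
  have hu : (u : V) ∈ C₁ := ⟨u.2, SimpleGraph.Reachable.refl _⟩
  have hv : (v : V) ∈ C₂ := ⟨v.2, fun ⟨_, h⟩ => huv h⟩
  have hC : ∀ p ∈ C₁, ∀ q ∈ C₂, p ≠ q := fun p hp q hq h => hq.2 (h ▸ hp)
  have hunion : C₁ ∪ C₂ = G.neighborSet x := by
    refine Set.union_sdiff_cancel ?_
    rintro w ⟨hw, -⟩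
    exact hw
  have hcl1 : (bcGraph G x).IsClique C₁ := by
    intro p hp q hq hpq
    rcases hind p q v hp.1 hq.1 v.2 hpq (hC _ hp _ hv) (hC _ hq _ hv) with h | h | h
    · exact h
    · exact (hcross _ hp _ hv h).elim
    · exact (hcross _ hq _ hv h).elim
  have hcl2 : (bcGraph G x).IsClique C₂ := by
    intro p hp q hq hpq
    rcases hind u p q u.2 hp.1 hq.1 (hC _ hu _ hp) (hC _ hu _ hq) hpq with h | h | h
    · exact (hcross _ hu _ hp h).elim
    · exact (hcross _ hu _ hq h).elim
    · exact h
  refine ⟨C₁, C₂, ⟨u, hu⟩, ⟨v, hv⟩, hunion, hcl1, hcl2, hcross, ?_⟩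
  intro z y₁ y₂ hz h1 h2 hz1 hz2
  exact hx ⟨hK, Or.inr ⟨C₁, C₂, hunion, Set.disjoint_sdiff_right, hcl1, hcl2, hcross,
    z, hz, ⟨y₁, h1, hz1⟩, ⟨y₂, h2, hz2⟩⟩⟩

/-- Two neighbours of `x` in the same part of `N(x)`, and a neighbour in the other part. -/
theorem exists_other_of_not_cEligible (hclaw : OHeavy claw G) (hx : ¬ CEligible G x)
    {a b : V} (ha : G.Adj x a) (hb : G.Adj x b) (hab : OHeavyPair G a b) :
    ∃ c, G.Adj x c ∧ c ≠ a ∧ c ≠ b ∧ ¬ G.Adj a c ∧ ¬ G.Adj b c ∧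
      (∀ y, G.Adj x y → G.Adj y a → ¬ G.Adj y c) ∧
      ∀ y, OHeavyPair G x y → G.Adj y a → ¬ G.Adj y c := by
  have hK : ¬ G.IsClique (G.neighborSet x) := fun h => hab.2.1 (h ha hb hab.1)
  obtain ⟨C₁, C₂, h1, h2, hu, hc1, hc2, hcr, hz⟩ := exists_cliques_of_not_cEligible hclaw hx hK
  have key : ∀ C₁ C₂ : Set V, C₂.Nonempty → C₁ ∪ C₂ = G.neighborSet x →
      (∀ u ∈ C₁, ∀ v ∈ C₂, ¬ (bcGraph G x).Adj u v) →
      (∀ z y₁ y₂ : V, OHeavyPair G x z → y₁ ∈ C₁ → y₂ ∈ C₂ → G.Adj z y₁ → ¬ G.Adj z y₂) →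
      a ∈ C₁ → ∃ c, G.Adj x c ∧ c ≠ a ∧ c ≠ b ∧ ¬ G.Adj a c ∧ ¬ G.Adj b c ∧
      (∀ y, G.Adj x y → G.Adj y a → ¬ G.Adj y c) ∧
      ∀ y, OHeavyPair G x y → G.Adj y a → ¬ G.Adj y c := by
    rintro C₁ C₂ ⟨c, hc⟩ hu hcr hz haC
    have hbc : (bcGraph G x).Adj a b := Or.inr ⟨ha, hb, hab⟩
    have same : ∀ y, G.Adj x y → (bcGraph G x).Adj a y → y ∈ C₁ := by
      intro y hy hay
      have : y ∈ C₁ ∪ C₂ := hu ▸ hy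
      exact this.resolve_right fun h => hcr a haC y h hay
    have hbC := same b hb hbc
    have hxc : G.Adj x c := by
      have : c ∈ C₁ ∪ C₂ := Or.inr hc
      rw [hu] at this
      exact this
    have hac : ¬ G.Adj a c := fun h => hcr a haC c hc (Or.inl h)
    have hbc' : ¬ G.Adj b c := fun h => hcr b hbC c hc (Or.inl h)
    refine ⟨c, hxc, ?_, ?_, hac, hbc', ?_, ?_⟩
    · rintro rfl
      exact hcr b hbC c hc hbc.symm
    · rintro rfl
      exact hcr a haC c hc hbc
    · intro y hy hya hyc
      exact hcr y (same y hy (Or.inl hya.symm)) c hc (Or.inl hyc)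
    · intro y hy hya
      exact hz y a c hy haC hc hya
  have : a ∈ C₁ ∪ C₂ := hu ▸ ha
  rcases this with h | h
  · exact key C₁ C₂ h2 hu hcr hz h
  · exact key C₂ C₁ h1 (Set.union_comm _ _ ▸ hu) (fun u hu v hv h => hcr v hv u hu h.symm)
      (fun z y₁ y₂ h h1 h2 h3 h4 => hz z y₂ y₁ h h2 h1 h4 h3) h

/-- A `K_{1,3}`-`o`-heavy graph without `c`-eligible vertices has no `o`-heavy pair. -/
theorem not_oHeavyPair_of_closed (hclaw : OHeavy claw G) (hcl : ∀ x, ¬ CEligible G x) (a b : V) :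
    ¬ OHeavyPair G a b := by
  intro hab
  -- To each common neighbour `x` of `a` and `b` assign a vertex `c` in the part of `N(x)` that
  -- avoids `a` and `b`. Elsewhere the value is a dummy.
  have hex : ∀ x : V, ∃ c, G.Adj a x → G.Adj b x → G.Adj x c ∧ c ≠ a ∧ c ≠ b ∧
      ¬ G.Adj a c ∧ ¬ G.Adj b c ∧ (∀ y, G.Adj x y → G.Adj y a → ¬ G.Adj y c) ∧
      ∀ y, OHeavyPair G x y → G.Adj y a → ¬ G.Adj y c := by
    intro x
    by_cases h : G.Adj a x ∧ G.Adj b x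
    · obtain ⟨c, hc⟩ := exists_other_of_not_cEligible hclaw (hcl x) h.1.symm h.2.symm hab
      exact ⟨c, fun _ _ => hc⟩
    · exact ⟨a, fun h1 h2 => (h ⟨h1, h2⟩).elim⟩
  choose c hc using hex
  -- If `x` and `y` were in different parts of `N(a)`, the `o`-heavy pair `{a, b}` would link these
  -- parts and make `a` eligible.
  have hpair : ∀ x y, G.Adj a x → G.Adj b x → G.Adj a y → G.Adj b y → x ≠ y →
      ¬ G.Adj x y → OHeavyPair G x y := by
    intro x y hax hbx hay hby hxy hn
    have hK : ¬ G.IsClique (G.neighborSet a) := fun h => hn (h hax hay hxy)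
    obtain ⟨C₁, C₂, h1, h2, hu, hc1, hc2, hcr, hz⟩ :=
      exists_cliques_of_not_cEligible hclaw (hcl a) hK
    have hx : x ∈ C₁ ∪ C₂ := hu ▸ hax
    have hy : y ∈ C₁ ∪ C₂ := hu ▸ hay
    have hbc : (bcGraph G a).Adj x y := by
      rcases hx with hx | hx <;> rcases hy with hy | hy
      · exact hc1 hx hy hxy
      · exact (hz b x y hab hx hy hbx hby).elim
      · exact (hz b y x hab hy hx hby hbx).elim
      · exact hc2 hx hy hxy
    exact (hbc.resolve_left hn).2.2
  -- If `x` and `y` share a value, then `y` touches both parts of `N(x)`: impossible for a neighbour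
  -- of `x`, and for an `o`-heavy partner of `x`. Injectivity then contradicts the count, as all
  -- values are missed by `a` and `b`.
  have hinj : Set.InjOn c (G.neighborSet a ∩ G.neighborSet b) := by
    rintro x ⟨hax, hbx⟩ y ⟨hay, hby⟩ hxy
    by_contra hne
    have hx := hc x hax hbx
    have hy := hc y hay hby
    rw [← hxy] at hy
    by_cases hadj : G.Adj x y
    · exact hx.2.2.2.2.2.1 y hadj hay.symm hy.1
    · exact hx.2.2.2.2.2.2 y (hpair x y hax hbx hay hby hne hadj) hay.symm hy.1
  have h1 := hab.ncard_lt (T := c '' (G.neighborSet a ∩ G.neighborSet b)) (by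
    rintro _ ⟨x, ⟨hax, hbx⟩, rfl⟩
    have hx := hc x hax hbx
    exact ⟨hx.2.1, hx.2.2.1, hx.2.2.2.1, hx.2.2.2.2.1⟩)
  rw [hinj.ncard_image] at h1
  omega

/-- Without `o`-heavy pairs `bcGraph` adds no edges, so `N(x)` is a clique or two cliques of `G`
with no edge between them. -/
theorem adj_trans_of_closed (hclaw : OHeavy claw G) (hcl : ∀ x, ¬ CEligible G x) {p q r : V}
    (hp : G.Adj x p) (hq : G.Adj x q) (hr : G.Adj x r) (hpq : G.Adj p q) (hqr : G.Adj q r)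
    (hpr : p ≠ r) : G.Adj p r := by
  by_cases hK : G.IsClique (G.neighborSet x)
  · exact hK hp hr hpr
  obtain ⟨C₁, C₂, h1, h2, hu, hc1, hc2, hcr, hz⟩ :=
    exists_cliques_of_not_cEligible hclaw (hcl x) hK
  have hbc : (bcGraph G x).Adj p r → G.Adj p r := fun h =>
    h.resolve_right fun h => not_oHeavyPair_of_closed hclaw hcl _ _ h.2.2
  have hp' : p ∈ C₁ ∪ C₂ := hu ▸ hp
  have hq' : q ∈ C₁ ∪ C₂ := hu ▸ hq
  have hr' : r ∈ C₁ ∪ C₂ := hu ▸ hr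
  have hpq' : (bcGraph G x).Adj p q := Or.inl hpq
  have hqr' : (bcGraph G x).Adj q r := Or.inl hqr
  rcases hq' with hq' | hq'
  · have h3 := hp'.resolve_right fun h => hcr q hq' p h hpq'.symm
    have h4 := hr'.resolve_right fun h => hcr q hq' r h hqr'
    exact hbc (hc1 h3 h4 hpr)
  · have h3 := hp'.resolve_left fun h => hcr p h q hq' hpq'
    have h4 := hr'.resolve_left fun h => hcr r h q hq' hqr'.symm
    exact hbc (hc2 h3 h4 hpr)

end Closed

/-! ### Links through simplicial vertices -/

section Linked

variable {V : Type*} {G G' : SimpleGraph V} {S T : Set V} {u v x : V}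

/-- The vertices whose neighbourhood is a clique. -/
def simplicial (G : SimpleGraph V) : Set V := {x | G.IsClique (G.neighborSet x)}

/-- `u` and `v` are joined by a walk of `G` with at least one edge and all inner vertices
in `S`. -/
inductive Linked (G : SimpleGraph V) (S : Set V) : V → V → Prop
  | edge {u v : V} : G.Adj u v → Linked G S u v
  | cons {u x v : V} : G.Adj u x → x ∈ S → Linked G S x v → Linked G S u v

theorem Linked.mono (hST : S ⊆ T) (h : Linked G S u v) : Linked G T u v := by
  induction h with
  | edge h => exact .edge h
  | cons h hx _ ih => exact .cons h (hST hx) ih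

theorem Linked.trans (h : Linked G S u x) (hx : x ∈ S) (h' : Linked G S x v) :
    Linked G S u v := by
  induction h with
  | edge h => exact .cons h hx h'
  | cons h hy _ ih => exact .cons h hy (ih hx h')

/-- If `y` gains a neighbour, then `x` is in `N(y)`. The old neighbours of `y` other than `x` are
then adjacent to `x`, so all of them fall into the completed clique. -/
theorem simplicial_subset_localCompletion (x : V) :
    simplicial G ⊆ simplicial (localCompletion G x) := by
  intro y hy p hp q hq hpq
  rcases hp with hp | ⟨hxy, hxp, hyp⟩ <;> rcases hq with hq | ⟨hxy', hxq, hyq⟩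
  · exact Or.inl (hy hp hq hpq)
  · by_cases hxp : x = p
    · subst hxp
      exact Or.inl hxq
    · exact Or.inr ⟨hy hxy'.symm hp hxp, hxq, hpq⟩
  · by_cases hxq : x = q
    · subst hxq
      exact Or.inl hxp.symm
    · exact Or.inr ⟨hxp, hy hxy.symm hq hxq, hpq⟩
  · exact Or.inr ⟨hxp, hxq, hpq⟩

theorem mem_simplicial_localCompletion (x : V) : x ∈ simplicial (localCompletion G x) := by
  intro p hp q hq hpq
  have key : ∀ p, p ∈ (localCompletion G x).neighborSet x → G.Adj x p := by
    rintro p (h | ⟨h, _⟩)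
    · exact h
    · exact (h.ne rfl).elim
  exact Or.inr ⟨key p hp, key q hq, hpq⟩

/-- An edge created by the completion at `x` is replaced by the detour through `x`, which is
simplicial from then on. -/
theorem linked_of_reflTransGen [Fintype V] (h : Relation.ReflTransGen CStep G G') :
    ∀ u v, G'.Adj u v → Linked G (simplicial G') u v := by
  induction h with
  | refl => exact fun u v h => .edge h
  | tail _ hs ih =>
    obtain ⟨x, -, rfl⟩ := hs
    rintro u v (huv | ⟨hu, hv, -⟩)
    · exact (ih u v huv).mono (simplicial_subset_localCompletion x)
    · exact ((ih u x hu.symm).mono (simplicial_subset_localCompletion x)).trans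
        (mem_simplicial_localCompletion x)
        ((ih x v hv).mono (simplicial_subset_localCompletion x))

theorem le_of_reflTransGen [Fintype V] (h : Relation.ReflTransGen CStep G G') : G ≤ G' := by
  induction h with
  | refl => exact le_rfl
  | tail _ hs ih => exact ih.trans hs.lt.le

theorem oHeavy_of_reflTransGen [Fintype V] (h : Relation.ReflTransGen CStep G G')
    (hG : OHeavy claw G) : OHeavy claw G' := by
  induction h with
  | refl => exact hG
  | tail _ hs ih =>
    obtain ⟨x, -, rfl⟩ := hs
    exact ih.localCompletion x

end Linked

/-- The relation between a `K_{1,3}`-`o`-heavy graph and its `c`-closures used below. -/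
structure ClosedOver {V : Type*} [Fintype V] (G G' : SimpleGraph V) : Prop where
  le : G ≤ G'
  linked : ∀ {u v}, G'.Adj u v → Linked G (simplicial G') u v
  not_large : ∀ {u v}, u ≠ v → ¬ G'.Adj u v → ¬ LargeDegreeSum G' u v
  claw_free : ∀ {x p q r}, G'.Adj x p → G'.Adj x q → G'.Adj x r → p ≠ q → p ≠ r → q ≠ r →
    ¬ G'.Adj p q → ¬ G'.Adj p r → G'.Adj q r
  adj_trans : ∀ {x p q r}, G'.Adj x p → G'.Adj x q → G'.Adj x r → G'.Adj p q → G'.Adj q r →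
    p ≠ r → G'.Adj p r
  claw_oHeavy : ∀ {x p q r}, G.Adj x p → G.Adj x q → G.Adj x r → p ≠ q → p ≠ r → q ≠ r →
    ¬ G.Adj p q → ¬ G.Adj p r → ¬ G.Adj q r →
    LargeDegreeSum G p q ∨ LargeDegreeSum G p r ∨ LargeDegreeSum G q r

theorem IsCClosure.closedOver {V : Type*} [Fintype V] {G G' : SimpleGraph V}
    (hclaw : OHeavy claw G) (h : IsCClosure G G') : ClosedOver G G' where
  le := le_of_reflTransGen h.1
  linked := linked_of_reflTransGen h.1 _ _
  not_large hne hn hL :=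
    not_oHeavyPair_of_closed (oHeavy_of_reflTransGen h.1 hclaw) h.2 _ _ ⟨hne, hn, hL⟩
  claw_free := by
    intro x p q r hp hq hr hpq hpr hqr npq npr
    by_contra nqr
    have hc := oHeavy_of_reflTransGen h.1 hclaw
    have hno := not_oHeavyPair_of_closed hc h.2
    rcases oHeavy_claw_iff.1 hc x p q r hp hq hr hpq hpr hqr npq npr nqr with h | h | h
    exacts [hno _ _ ⟨hpq, npq, h⟩, hno _ _ ⟨hpr, npr, h⟩, hno _ _ ⟨hqr, nqr, h⟩]
  adj_trans hp hq hr hpq hqr hpr :=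
    adj_trans_of_closed (oHeavy_of_reflTransGen h.1 hclaw) h.2 hp hq hr hpq hqr hpr
  claw_oHeavy := oHeavy_claw_iff.1 hclaw _ _ _ _

theorem ClosedOver.clawFree {V : Type*} [Fintype V] {G G' : SimpleGraph V}
    (h : ClosedOver G G') : ClawFree G' := by
  rintro ⟨f⟩
  have hadj : ∀ i, G'.Adj (f (Sum.inl 0)) (f (Sum.inr i)) := fun i => by
    rw [f.map_adj_iff]; simp
  have hnadj : ∀ i j, ¬ G'.Adj (f (Sum.inr i)) (f (Sum.inr j)) := fun i j => by
    rw [f.map_adj_iff]; simp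
  have hne : ∀ i j : Fin 3, i ≠ j → f (Sum.inr i) ≠ f (Sum.inr j) := fun i j hij he =>
    hij (Sum.inr_injective (f.injective he))
  exact hnadj 1 2 (h.claw_free (hadj 0) (hadj 1) (hadj 2) (hne 0 1 (by decide))
    (hne 0 2 (by decide)) (hne 1 2 (by decide)) (hnadj _ _) (hnadj _ _))

/-! ### Induced subgraphs without `o`-heavy pairs -/

section Light

variable {V W : Type*} [Fintype V] {G G' : SimpleGraph V} {u v : V}

/-- `u` and `v` are distinct, nonadjacent and do not form an `o`-heavy pair. -/
def Light (G : SimpleGraph V) (u v : V) : Prop :=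
  u ≠ v ∧ ¬ G.Adj u v ∧ ¬ LargeDegreeSum G u v

theorem Light.symm (h : Light G u v) : Light G v u :=
  ⟨h.1.symm, fun h' => h.2.1 h'.symm, fun h' => h.2.2 h'.symm⟩

/-- An induced copy of `H` all of whose nonadjacent pairs are light contradicts
`H`-`o`-heaviness. -/
theorem OHeavy.false_of_light {n : ℕ} {H : SimpleGraph (Fin n)} (h : OHeavy H G) (φ : Fin n → V)
    (hφ : ∀ i j, i < j → (H.Adj i j ∧ G.Adj (φ i) (φ j)) ∨ (¬ H.Adj i j ∧ Light G (φ i) (φ j))) :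
    False := by
  have hφ' : ∀ i j, i ≠ j →
      (H.Adj i j ∧ G.Adj (φ i) (φ j)) ∨ (¬ H.Adj i j ∧ Light G (φ i) (φ j)) := by
    intro i j hij
    rcases lt_or_gt_of_ne hij with hlt | hlt
    · exact hφ i j hlt
    · rcases hφ j i hlt with ⟨h1, h2⟩ | ⟨h1, h2⟩
      · exact Or.inl ⟨h1.symm, h2.symm⟩
      · exact Or.inr ⟨fun h => h1 h.symm, h2.symm⟩
  have hinj : Function.Injective φ := by
    intro i j hij
    by_contra hne
    rcases hφ' i j hne with ⟨-, h2⟩ | ⟨-, h2⟩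
    · exact h2.ne hij
    · exact h2.1 hij
  have hadj : ∀ {i j}, G.Adj (φ i) (φ j) ↔ H.Adj i j := by
    intro i j
    by_cases hij : i = j
    · subst hij
      simp
    · rcases hφ' i j hij with ⟨h1, h2⟩ | ⟨h1, h2⟩
      · exact ⟨fun _ => h1, fun _ => h2⟩
      · exact ⟨fun h => (h2.2.1 h).elim, fun h => (h1 h).elim⟩
  obtain ⟨i, j, hne, hn, hL⟩ := h ⟨⟨φ, hinj⟩, hadj⟩
  have hij : i ≠ j := fun h => hne (h ▸ rfl)
  rcases hφ' i j hij with ⟨-, h2⟩ | ⟨-, h2⟩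
  · exact hn h2
  · exact h2.2.2 hL

theorem OHeavy.of_embedding {W' : Type*} {H : SimpleGraph W} {K : SimpleGraph W'}
    (h : OHeavy H G) (f : H ↪g K) : OHeavy K G := fun g => by
  obtain ⟨i, j, hij⟩ := h (g.comp f)
  exact ⟨f i, f j, hij⟩

theorem false_of_light_P₅ (h : OHeavy (SimpleGraph.pathGraph 5) G) {x₀ x₁ x₂ x₃ x₄ : V}
    (h01 : G.Adj x₀ x₁) (h12 : G.Adj x₁ x₂) (h23 : G.Adj x₂ x₃) (h34 : G.Adj x₃ x₄)
    (l02 : Light G x₀ x₂) (l03 : Light G x₀ x₃) (l04 : Light G x₀ x₄) (l13 : Light G x₁ x₃)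
    (l14 : Light G x₁ x₄) (l24 : Light G x₂ x₄) : False := by
  refine h.false_of_light ![x₀, x₁, x₂, x₃, x₄] fun i j hij => ?_
  fin_cases i <;> fin_cases j <;> simp_all [SimpleGraph.pathGraph_adj]

theorem false_of_light_Z₂ (h : OHeavy Z₂ G) {x₀ x₁ x₂ x₃ x₄ : V}
    (h01 : G.Adj x₀ x₁) (h02 : G.Adj x₀ x₂) (h12 : G.Adj x₁ x₂) (h23 : G.Adj x₂ x₃)
    (h34 : G.Adj x₃ x₄) (l03 : Light G x₀ x₃) (l04 : Light G x₀ x₄) (l13 : Light G x₁ x₃)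
    (l14 : Light G x₁ x₄) (l24 : Light G x₂ x₄) : False := by
  refine h.false_of_light ![x₀, x₁, x₂, x₃, x₄] fun i j hij => ?_
  fin_cases i <;> fin_cases j <;> simp_all [Z₂]

theorem false_of_light_net (h : OHeavy net G) {x₀ x₁ x₂ x₃ x₄ x₅ : V}
    (h01 : G.Adj x₀ x₁) (h02 : G.Adj x₀ x₂) (h12 : G.Adj x₁ x₂) (h03 : G.Adj x₀ x₃)
    (h14 : G.Adj x₁ x₄) (h25 : G.Adj x₂ x₅) (l04 : Light G x₀ x₄) (l05 : Light G x₀ x₅)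
    (l13 : Light G x₁ x₃) (l15 : Light G x₁ x₅) (l23 : Light G x₂ x₃) (l24 : Light G x₂ x₄)
    (l34 : Light G x₃ x₄) (l35 : Light G x₃ x₅) (l45 : Light G x₄ x₅) : False := by
  refine h.false_of_light ![x₀, x₁, x₂, x₃, x₄, x₅] fun i j hij => ?_
  fin_cases i <;> fin_cases j <;> simp_all [net]

theorem nonempty_embedding_net {n : ℕ} {H : SimpleGraph (Fin n)} (φ : Fin n → Fin 6)
    (hinj : Function.Injective φ) (h : ∀ i j, net.Adj (φ i) (φ j) ↔ H.Adj i j) :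
    Nonempty (H ↪g net) := ⟨⟨φ, hinj⟩, h _ _⟩

theorem pathGraph_four_embedding_net : Nonempty (SimpleGraph.pathGraph 4 ↪g net) := by
  refine nonempty_embedding_net ![3, 0, 1, 4] (by decide) fun i j => ?_
  fin_cases i <;> fin_cases j <;> simp [net, SimpleGraph.pathGraph_adj]

theorem cycleGraph_three_embedding_net : Nonempty (SimpleGraph.cycleGraph 3 ↪g net) := by
  refine nonempty_embedding_net ![0, 1, 2] (by decide) fun i j => ?_
  fin_cases i <;> fin_cases j <;> simp [net, SimpleGraph.cycleGraph_adj] <;> decide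

theorem Z₁_embedding_net : Nonempty (Z₁ ↪g net) := by
  refine nonempty_embedding_net ![0, 1, 2, 5] (by decide) fun i j => ?_
  fin_cases i <;> fin_cases j <;> simp [net, Z₁]

theorem bull_embedding_net : Nonempty (bull ↪g net) := by
  refine nonempty_embedding_net ![0, 1, 2, 3, 4] (by decide) fun i j => ?_
  fin_cases i <;> fin_cases j <;> simp [net, bull]

end Light

/-! ### Shortest links -/

section Paths

variable {V : Type*} {G : SimpleGraph V} {S : Set V} {u v : V}

/-- `p 0, …, p k` is a walk of `G` from `u` to `v` with all inner vertices in `S`. -/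
structure IsLink (G : SimpleGraph V) (S : Set V) (u v : V) (p : ℕ → V) (k : ℕ) : Prop where
  zero : p 0 = u
  last : p k = v
  adj : ∀ i < k, G.Adj (p i) (p (i + 1))
  mem : ∀ i, 0 < i → i < k → p i ∈ S

theorem Linked.exists_isLink (h : Linked G S u v) : ∃ p k, 0 < k ∧ IsLink G S u v p k := by
  induction h with
  | @edge u v h =>
    refine ⟨fun i => if i = 0 then u else v, 1, one_pos, rfl, rfl, ?_, ?_⟩
    · intro i hi
      obtain rfl : i = 0 := by omega
      exact h
    · intro i h1 h2
      omega
  | @cons u x v h hx _ ih =>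
    obtain ⟨p, k, hk, hp⟩ := ih
    refine ⟨fun i => if i = 0 then u else p (i - 1), k + 1, by omega, by simp, by simp [hp.last],
      ?_, ?_⟩
    · intro i hi
      rcases i with _ | i
      · simpa [hp.zero] using h
      · simpa using hp.adj i (by omega)
    · intro i h1 h2
      rcases i with _ | _ | i
      · omega
      · simpa [hp.zero] using hx
      · simpa using hp.mem (i + 1) (by omega) (by omega)

theorem IsLink.shortcut {p : ℕ → V} {k i j : ℕ} (h : IsLink G S u v p k) (hij : i + 1 < j)
    (hj : j ≤ k) (hadj : G.Adj (p i) (p j)) :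
    IsLink G S u v (fun t => if t ≤ i then p t else p (t + (j - i - 1))) (k - (j - i - 1)) where
  zero := by simp [h.zero]
  last := by
    rw [if_neg (by omega), ← h.last]
    congr 1
    omega
  adj := by
    intro t ht
    rcases lt_trichotomy t i with hti | rfl | hti
    · rw [if_pos (by omega), if_pos (by omega)]
      exact h.adj t (by omega)
    · rw [if_pos le_rfl, if_neg (by omega)]
      convert hadj using 2
      omega
    · rw [if_neg (by omega), if_neg (by omega)]
      convert h.adj (t + (j - i - 1)) (by omega) using 2
      omega
  mem := by
    intro t h1 h2
    by_cases hti : t ≤ i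
    · rw [if_pos hti]
      exact h.mem t h1 (by omega)
    · rw [if_neg hti]
      exact h.mem _ (by omega) (by omega)

/-- A shortest link has no chords. -/
theorem Linked.exists_induced (h : Linked G S u v) (huv : u ≠ v) (hn : ¬ G.Adj u v) :
    ∃ p k, 2 ≤ k ∧ IsLink G S u v p k ∧
      ∀ i j, i + 1 < j → j ≤ k → p i ≠ p j ∧ ¬ G.Adj (p i) (p j) := by
  classical
  have hex : ∃ k, ∃ p, IsLink G S u v p k := by
    obtain ⟨p, k, -, hp⟩ := h.exists_isLink
    exact ⟨k, p, hp⟩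
  obtain ⟨p, hp⟩ := Nat.find_spec hex
  have hmin : ∀ k q, IsLink G S u v q k → Nat.find hex ≤ k := fun k q hq =>
    Nat.find_min' hex ⟨q, hq⟩
  have hk : 2 ≤ Nat.find hex := by
    by_contra hlt
    have h0 := hp.zero
    have h1 := hp.last
    obtain hk | hk : Nat.find hex = 0 ∨ Nat.find hex = 1 := by omega
    · rw [hk, h0] at h1
      exact huv h1
    · have := hp.adj 0 (by omega)
      rw [hk] at h1
      rw [h0, zero_add, h1] at this
      exact hn this
  have hchord : ∀ i j, i + 1 < j → j ≤ Nat.find hex → ¬ G.Adj (p i) (p j) := by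
    intro i j hij hj hadj
    have := hmin _ _ (hp.shortcut hij hj hadj)
    omega
  refine ⟨p, Nat.find hex, hk, hp, fun i j hij hj => ⟨fun he => ?_, hchord i j hij hj⟩⟩
  -- A repeated vertex also gives a chord: from `i` to `j + 1`, or from `i - 1` to `j`, unless the
  -- two ends coincide.
  by_cases hjk : j < Nat.find hex
  · have h1 := hp.adj j hjk
    rw [← he] at h1
    exact hchord i (j + 1) (by omega) hjk h1
  · obtain rfl : j = Nat.find hex := by omega
    by_cases hi : i = 0
    · subst hi
      rw [hp.zero, hp.last] at he
      exact huv he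
    · have h1 := hp.adj (i - 1) (by omega)
      rw [Nat.sub_add_cancel (by omega), he] at h1
      exact hchord (i - 1) _ (by omega) le_rfl h1

end Paths

/-! ### Nets in the closure -/

section Consecutive

variable {V : Type*} [Fintype V] {G : SimpleGraph V}

/-- A vertex with a unique pair of consecutive neighbours on an induced path. -/
theorem exists_consecutive_neighbors
    (hclaw : ∀ {x p q r}, G.Adj x p → G.Adj x q → G.Adj x r → Light G p q → Light G p r →
      Light G q r → False) {e : ℕ → V} {m : ℕ}
    (hadj : ∀ i < m, G.Adj (e i) (e (i + 1)))
    (hl : ∀ i j, i + 1 < j → j ≤ m → Light G (e i) (e j)) {q q' : V} (hq : G.Adj q q')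
    (hq' : ∀ i ≤ m, Light G q' (e i)) (hqe : ∀ i ≤ m, G.Adj q (e i) ∨ Light G q (e i))
    (h0 : Light G q (e 0)) (hm : Light G q (e m)) (hex : ∃ i ≤ m, G.Adj q (e i)) :
    ∃ i, 0 < i ∧ i + 1 < m ∧ G.Adj q (e i) ∧ G.Adj q (e (i + 1)) ∧
      ∀ j ≤ m, j ≠ i → j ≠ i + 1 → Light G q (e j) := by
  have hpair : ∀ i, i + 1 ≤ m → G.Adj q (e i) → G.Adj q (e (i + 1)) →
      ∃ i, 0 < i ∧ i + 1 < m ∧ G.Adj q (e i) ∧ G.Adj q (e (i + 1)) ∧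
      ∀ j ≤ m, j ≠ i → j ≠ i + 1 → Light G q (e j) := by
    intro i him h1 h2
    refine ⟨i, Nat.pos_of_ne_zero ?_, lt_of_le_of_ne him ?_, h1, h2, fun j hj hji hji' => ?_⟩
    · rintro rfl
      exact h0.2.1 h1
    · intro h
      rw [h] at h2
      exact hm.2.1 h2
    -- A third neighbour on the path would form a light claw at `q` with `q'` and the farther vertex
    -- of the pair.
    · refine (hqe j hj).resolve_left fun hqj => ?_
      rcases lt_or_gt_of_ne hji with hlt | hlt
      · exact hclaw hq hqj h2 (hq' j hj) (hq' (i + 1) him) (hl j (i + 1) (by omega) him)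
      · exact hclaw hq h1 hqj (hq' i (by omega)) (hq' j hj) (hl i j (by omega) hj)
  obtain ⟨i, him, hqi⟩ := hex
  have hi0 : i ≠ 0 := by
    rintro rfl
    exact h0.2.1 hqi
  have him' : i ≠ m := by
    rintro rfl
    exact hm.2.1 hqi
  obtain ⟨i, rfl⟩ := Nat.exists_eq_succ_of_ne_zero hi0
  rcases hqe i (by omega) with h | h
  · exact hpair i (by omega) h hqi
  rcases hqe (i + 1 + 1) (by omega) with h' | h'
  · exact hpair (i + 1) (by omega) hqi h'
  -- A neighbour of `q` with neither path neighbour adjacent to `q` is the centre of a light claw.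
  exact (hclaw hqi.symm (hadj i (by omega)).symm (hadj (i + 1) (by omega)) h h'
    (hl i (i + 2) (by omega) (by omega))).elim

end Consecutive

/-! ### Induced nets and their simplicial vertices. -/

section Net

variable {V : Type*} {G : SimpleGraph V} {a b c a' b' c' s : V}

/-- `a b c` is the triangle of an induced net of `G` with the pendant edges `a a'`, `b b'`
and `c c'`. -/
structure IsNet (G : SimpleGraph V) (a b c a' b' c' : V) : Prop where
  ab : G.Adj a b
  bc : G.Adj b c
  ac : G.Adj a c
  aa' : G.Adj a a'
  bb' : G.Adj b b'
  cc' : G.Adj c c'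
  nab' : ¬ G.Adj a b'
  nac' : ¬ G.Adj a c'
  nba' : ¬ G.Adj b a'
  nbc' : ¬ G.Adj b c'
  nca' : ¬ G.Adj c a'
  ncb' : ¬ G.Adj c b'
  na'b' : ¬ G.Adj a' b'
  na'c' : ¬ G.Adj a' c'
  nb'c' : ¬ G.Adj b' c'

namespace IsNet

/-- Together with `rotate` this generates all relabellings; `rotate.swap` exchanges `a` and `c` and
fixes `b`. -/
theorem swap (h : IsNet G a b c a' b' c') : IsNet G b a c b' a' c' where
  ab := h.ab.symm
  bc := h.ac
  ac := h.bc
  aa' := h.bb'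
  bb' := h.aa'
  cc' := h.cc'
  nab' := h.nba'
  nac' := h.nbc'
  nba' := h.nab'
  nbc' := h.nac'
  nca' := h.ncb'
  ncb' := h.nca'
  na'b' := fun h' => h.na'b' h'.symm
  na'c' := h.nb'c'
  nb'c' := h.na'c'

theorem rotate (h : IsNet G a b c a' b' c') : IsNet G b c a b' c' a' where
  ab := h.bc
  bc := h.ac.symm
  ac := h.ab.symm
  aa' := h.bb'
  bb' := h.cc'
  cc' := h.aa'
  nab' := h.nbc'
  nac' := h.nba'
  nba' := h.ncb'
  nbc' := h.nca'
  nca' := h.nab'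
  ncb' := h.nac'
  na'b' := h.nb'c'
  na'c' := fun h' => h.na'b' h'.symm
  nb'c' := fun h' => h.na'c' h'.symm

theorem ne_ab' (h : IsNet G a b c a' b' c') : a ≠ b' := fun he => h.na'b' (he ▸ h.aa'.symm)

theorem ne_ac' (h : IsNet G a b c a' b' c') : a ≠ c' := fun he => h.na'c' (he ▸ h.aa'.symm)

theorem ne_ba' (h : IsNet G a b c a' b' c') : b ≠ a' := h.swap.ne_ab'

theorem ne_bc' (h : IsNet G a b c a' b' c') : b ≠ c' := h.swap.ne_ac'

theorem ne_ca' (h : IsNet G a b c a' b' c') : c ≠ a' := h.rotate.ne_bc'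

theorem ne_cb' (h : IsNet G a b c a' b' c') : c ≠ b' := h.rotate.ne_ba'

theorem ne_a'b' (h : IsNet G a b c a' b' c') : a' ≠ b' := fun he => h.nab' (he ▸ h.aa')

theorem ne_a'c' (h : IsNet G a b c a' b' c') : a' ≠ c' := fun he => h.nac' (he ▸ h.aa')

theorem ne_b'c' (h : IsNet G a b c a' b' c') : b' ≠ c' := fun he => h.nbc' (he ▸ h.bb')

theorem notMem_simplicial (h : IsNet G a b c a' b' c') : a ∉ simplicial G := fun hs =>
  h.nba' (hs h.ab h.aa' h.ne_ba')

end IsNet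

theorem isNet_of_embedding (g : net ↪g G) : IsNet G (g 0) (g 1) (g 2) (g 3) (g 4) (g 5) := by
  constructor <;> rw [g.map_adj_iff] <;> simp [net]

/-- A simplicial vertex adjacent to two vertices of the triangle of a net. -/
theorem IsNet.simplicial_facts (h : IsNet G a b c a' b' c')
    (htr : ∀ {x p q r}, G.Adj x p → G.Adj x q → G.Adj x r → G.Adj p q → G.Adj q r →
      p ≠ r → G.Adj p r) (hs : s ∈ simplicial G) (ha : G.Adj s a) (hb : G.Adj s b) :
    G.Adj s c ∧ (s ≠ a' ∧ ¬ G.Adj s a') ∧ (s ≠ b' ∧ ¬ G.Adj s b') ∧ (s ≠ c' ∧ ¬ G.Adj s c') := by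
  refine ⟨htr ha.symm h.ab h.ac hb h.bc ?_, ⟨?_, fun h' => ?_⟩, ⟨?_, fun h' => ?_⟩,
    ⟨?_, fun h' => ?_⟩⟩
  · rintro rfl
    exact h.rotate.rotate.notMem_simplicial hs
  · rintro rfl
    exact h.nba' hb.symm
  · exact h.nba' (hs hb h' h.ne_ba')
  · rintro rfl
    exact h.nab' ha.symm
  · exact h.nab' (hs ha h' h.ne_ab')
  · rintro rfl
    exact h.nac' ha.symm
  · exact h.nac' (hs ha h' h.ne_ac')

/-- The closed neighbourhood of `s` is a clique containing `a`. -/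
theorem ncard_le_of_mem_simplicial [Fintype V] (hs : s ∈ simplicial G) (h : G.Adj s a) :
    (G.neighborSet s).ncard ≤ (G.neighborSet a).ncard := by
  have h1 : insert s (G.neighborSet s \ {a}) ⊆ G.neighborSet a := by
    rintro y (rfl | ⟨hy, hya⟩)
    · exact h.symm
    · exact hs h hy fun he => hya he.symm
  have h2 := Set.ncard_le_ncard h1 (Set.toFinite _)
  rw [Set.ncard_insert_of_notMem (fun h => h.1.ne rfl) (Set.toFinite _)] at h2
  have h3 := Set.ncard_sdiff_singleton_add_one (a := a) (s := G.neighborSet s) h (Set.toFinite _)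
  omega

/-- The vertices of a triangle and the simplicial vertices adjacent to all of them. -/
def InCore (G : SimpleGraph V) (a b c x : V) : Prop :=
  x = a ∨ x = b ∨ x = c ∨ (x ∈ simplicial G ∧ G.Adj x a ∧ G.Adj x b ∧ G.Adj x c)

/-- A simplicial vertex of the core has degree at most that of each of `a`, `b`, `c`, so every pair
is dominated by a pair of the triangle. -/
theorem InCore.not_large [Fintype V] {x y : V} (hx : InCore G a b c x) (hy : InCore G a b c y)
    (hxy : x ≠ y) (hab : ¬ LargeDegreeSum G a b) (hbc : ¬ LargeDegreeSum G b c)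
    (hac : ¬ LargeDegreeSum G a c) : ¬ LargeDegreeSum G x y := by
  rw [largeDegreeSum_iff] at *
  have key : ∀ x, x ∈ simplicial G ∧ G.Adj x a ∧ G.Adj x b ∧ G.Adj x c →
      (G.neighborSet x).ncard ≤ (G.neighborSet a).ncard ∧
      (G.neighborSet x).ncard ≤ (G.neighborSet b).ncard ∧
      (G.neighborSet x).ncard ≤ (G.neighborSet c).ncard := fun x hx =>
    ⟨ncard_le_of_mem_simplicial hx.1 hx.2.1, ncard_le_of_mem_simplicial hx.1 hx.2.2.1,
      ncard_le_of_mem_simplicial hx.1 hx.2.2.2⟩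
  rcases hx with rfl | rfl | rfl | hx <;> rcases hy with rfl | rfl | rfl | hy <;>
    first
      | exact (hxy rfl).elim
      | (have h1 := key _ hx; have h2 := key _ hy; omega)
      | (have h1 := key _ hx; omega)
      | (have h2 := key _ hy; omega)
      | omega

end Net

/-! ### Light pairs, cliques of the closure, and pendant edges in `G`. -/

section ClosedNet

variable {V : Type*} [Fintype V] {G G' : SimpleGraph V} {a b c a' b' c' u v : V}

namespace ClosedOver

theorem light (C : ClosedOver G G') (hne : u ≠ v) (hn : ¬ G'.Adj u v) : Light G u v :=
  ⟨hne, fun h => hn (C.le h), fun h => C.not_large hne hn (h.mono C.le)⟩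

theorem false_of_claw (C : ClosedOver G G') {x p q r : V} (hp : G.Adj x p) (hq : G.Adj x q)
    (hr : G.Adj x r) (lpq : Light G p q) (lpr : Light G p r) (lqr : Light G q r) : False := by
  rcases C.claw_oHeavy hp hq hr lpq.1 lpr.1 lqr.1 lpq.2.1 lpr.2.1 lqr.2.1 with h | h | h
  exacts [lpq.2.2 h, lpr.2.2 h, lqr.2.2 h]

theorem eq_or_adj_of_linked (C : ClosedOver G G') (h : Linked G (simplicial G') u v) :
    u = v ∨ G'.Adj u v := by
  induction h with
  | edge h => exact Or.inr (C.le h)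
  | @cons u x v h hx _ ih =>
    rcases ih with rfl | h'
    · exact Or.inr (C.le h)
    · by_cases huv : u = v
      · exact Or.inl huv
      · exact Or.inr (hx (C.le h).symm h' huv)

/-- An edge of the closure yields an edge of `G` in the same clique. -/
theorem exists_adj (C : ClosedOver G G') (h : G'.Adj u v) :
    ∃ w, G.Adj u w ∧ (w = v ∨ (w ∈ simplicial G' ∧ G'.Adj w v)) := by
  cases C.linked h with
  | edge h => exact ⟨v, h, Or.inl rfl⟩
  | @cons _ w _ h' hw h'' =>
    refine ⟨w, h', ?_⟩
    rcases C.eq_or_adj_of_linked h'' with h | h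
    exacts [Or.inl h, Or.inr ⟨hw, h⟩]

/-- Successive inner vertices are simplicial in `G'`, so a link stays within one clique of `G'`. -/
theorem eq_or_adj_of_isLink (C : ClosedOver G G') {p : ℕ → V} {k : ℕ}
    (h : IsLink G (simplicial G') u v p k) {i j : ℕ} (hij : i < j) (hj : j ≤ k) :
    p i = p j ∨ G'.Adj (p i) (p j) := by
  induction j, hij using Nat.le_induction with
  | base => exact Or.inr (C.le (h.adj i (by omega)))
  | succ j hij ih =>
    have h1 := C.le (h.adj j (by omega))
    have h2 := h.mem j (by omega) (by omega)
    rcases ih (by omega) with h3 | h3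
    · exact Or.inr (h3 ▸ h1)
    · by_cases he : p i = p (j + 1)
      · exact Or.inl he
      · exact Or.inr (h2 h3.symm h1 he)

/-- The first three vertices of a shortest link between nonadjacent vertices of a clique. -/
theorem exists_two_steps (C : ClosedOver G G') (h : G'.Adj u v) (hn : ¬ G.Adj u v) :
    ∃ x y, G.Adj u x ∧ G.Adj x y ∧ u ≠ y ∧ ¬ G.Adj u y ∧
      (x ∈ simplicial G' ∧ G'.Adj x v) ∧ (y = v ∨ (y ∈ simplicial G' ∧ G'.Adj y v)) ∧
      G'.Adj u y := by
  obtain ⟨p, k, hk, hp, hch⟩ := (C.linked h).exists_induced h.ne hn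
  have hadj : ∀ i j, i < j → j ≤ k → G'.Adj (p i) (p j) := by
    intro i j hij hj
    refine (C.eq_or_adj_of_isLink hp hij hj).resolve_left ?_
    rcases Nat.eq_or_lt_of_le (Nat.succ_le_of_lt hij) with rfl | hlt
    · exact (hp.adj i (by omega)).ne
    · exact (hch i j hlt hj).1
  have h0 := hp.zero
  have h1 := hp.last
  subst h0 h1
  refine ⟨p 1, p 2, hp.adj 0 (by omega), hp.adj 1 (by omega), (hch 0 2 (by omega) hk).1,
    (hch 0 2 (by omega) hk).2, ⟨hp.mem 1 (by omega) (by omega), hadj 1 k (by omega) le_rfl⟩, ?_,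
    hadj 0 2 (by omega) hk⟩
  rcases Nat.eq_or_lt_of_le hk with rfl | hlt
  · exact Or.inl rfl
  · exact Or.inr ⟨hp.mem 2 (by omega) hlt, hadj 2 k hlt le_rfl⟩

end ClosedOver

/-- The pendant edges of a net of the closure can be chosen in `G`. -/
theorem IsNet.exists_pendant (C : ClosedOver G G') (N : IsNet G' a b c a' b' c') :
    ∃ w, G.Adj a w ∧ IsNet G' a b c w b' c' := by
  obtain ⟨w, hw, rfl | ⟨hs, hwa⟩⟩ := C.exists_adj N.aa'
  · exact ⟨w, hw, N⟩
  · exact ⟨w, hw, N.ab, N.bc, N.ac, C.le hw, N.bb', N.cc', N.nab', N.nac',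
      fun h => N.nba' (hs h.symm hwa N.ne_ba'), N.nbc',
      fun h => N.nca' (hs h.symm hwa N.ne_ca'), N.ncb',
      fun h => N.na'b' (hs hwa h N.ne_a'b'), fun h => N.na'c' (hs hwa h N.ne_a'c'), N.nb'c'⟩

end ClosedNet

section ExtendPath

variable {V : Type*}

/-- The path `u, p 0, …, p k, v`. -/
def extendPath (u : V) (p : ℕ → V) (k : ℕ) (v : V) (i : ℕ) : V :=
  if i = 0 then u else if i ≤ k + 1 then p (i - 1) else v

theorem extendPath_cases (u : V) (p : ℕ → V) (k : ℕ) (v : V) {i : ℕ} (hi : i ≤ k + 2) :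
    (i = 0 ∧ extendPath u p k v i = u) ∨ (∃ j ≤ k, i = j + 1 ∧ extendPath u p k v i = p j) ∨
      (i = k + 2 ∧ extendPath u p k v i = v) := by
  unfold extendPath
  split_ifs with h1 h2
  · exact Or.inl ⟨h1, rfl⟩
  · exact Or.inr (Or.inl ⟨i - 1, by omega, by omega, rfl⟩)
  · exact Or.inr (Or.inr ⟨by omega, rfl⟩)

end ExtendPath

/-! ### The triangle of a net lies in `G`. -/

section Triangle

variable {V : Type*} [Fintype V] {G G' : SimpleGraph V} {a b c a' b' c' : V}

/-- The triangle of a net of the closure without large degree sums is a triangle of `G`. -/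
theorem IsNet.adj_of_not_large (C : ClosedOver G G') (N : IsNet G' a b c a' b' c')
    (haa' : G.Adj a a') (hbb' : G.Adj b b') (hcc' : G.Adj c c')
    (hab : ¬ LargeDegreeSum G' a b) (hbc : ¬ LargeDegreeSum G' b c)
    (hac : ¬ LargeDegreeSum G' a c)
    (hS : OHeavy net G ∨ OHeavy (SimpleGraph.pathGraph 5) G ∨ OHeavy Z₂ G) : G.Adj a b := by
  classical
  by_contra hn
  obtain ⟨p, k, hk, hp, hch⟩ := (C.linked N.ab).exists_induced N.ab.ne hn
  have hadj : ∀ i j, i < j → j ≤ k → G'.Adj (p i) (p j) := by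
    intro i j hij hj
    refine (C.eq_or_adj_of_isLink hp hij hj).resolve_left ?_
    rcases Nat.eq_or_lt_of_le (Nat.succ_le_of_lt hij) with rfl | hlt
    · exact (hp.adj i (by omega)).ne
    · exact (hch i j hlt hj).1
  have hp0 := hp.zero
  have hpk := hp.last
  have hin : ∀ i, 0 < i → i < k → p i ∈ simplicial G' ∧ G'.Adj (p i) a ∧ G'.Adj (p i) b := by
    intro i h1 h2
    refine ⟨hp.mem i h1 h2, ?_, ?_⟩
    · rw [← hp0]
      exact (hadj 0 i h1 h2.le).symm
    · rw [← hpk]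
      exact hadj i k h2 le_rfl
  have core_of : ∀ x, x ∈ simplicial G' → G'.Adj x a → G'.Adj x b → InCore G' a b c x :=
    fun x h1 h2 h3 => Or.inr (Or.inr (Or.inr
      ⟨h1, h2, h3, (N.simplicial_facts C.adj_trans h1 h2 h3).1⟩))
  have hcases : ∀ i ≤ k, (i = 0 ∧ p i = a) ∨ (i = k ∧ p i = b) ∨ (0 < i ∧ i < k) := by
    intro i hi
    rcases Nat.eq_zero_or_pos i with rfl | h
    · exact Or.inl ⟨rfl, hp0⟩
    · rcases Nat.eq_or_lt_of_le hi with rfl | h'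
      · exact Or.inr (Or.inl ⟨rfl, hpk⟩)
      · exact Or.inr (Or.inr ⟨h, h'⟩)
  have hcore : ∀ i ≤ k, InCore G' a b c (p i) := by
    intro i hi
    rcases hcases i hi with ⟨-, h⟩ | ⟨-, h⟩ | ⟨h1, h2⟩
    · exact Or.inl h
    · exact Or.inr (Or.inl h)
    · obtain ⟨h3, h4, h5⟩ := hin i h1 h2
      exact core_of _ h3 h4 h5
  have core_light : ∀ x y, InCore G' a b c x → InCore G' a b c y → x ≠ y → ¬ G.Adj x y →
      Light G x y := fun x y hx hy hne hnadj =>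
    ⟨hne, hnadj, fun h => hx.not_large hy hne hab hbc hac (h.mono C.le)⟩
  have light_a' : ∀ x, InCore G' a b c x → x ≠ a → Light G a' x := by
    rintro x (h | rfl | rfl | ⟨h1, h2, h3, -⟩) hxa
    · exact (hxa h).elim
    · exact C.light N.ne_ba'.symm fun h => N.nba' h.symm
    · exact C.light N.ne_ca'.symm fun h => N.nca' h.symm
    · have h := (N.simplicial_facts C.adj_trans h1 h2 h3).2.1
      exact (C.light h.1 h.2).symm
  have light_b' : ∀ x, InCore G' a b c x → x ≠ b → Light G b' x := by
    rintro x (rfl | h | rfl | ⟨h1, h2, h3, -⟩) hxb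
    · exact C.light N.ne_ab'.symm fun h => N.nab' h.symm
    · exact (hxb h).elim
    · exact C.light N.ne_cb'.symm fun h => N.ncb' h.symm
    · have h := (N.simplicial_facts C.adj_trans h1 h2 h3).2.2.1
      exact (C.light h.1 h.2).symm
  have light_c' : ∀ x, InCore G' a b c x → x ≠ c → Light G c' x := by
    rintro x (rfl | rfl | h | ⟨h1, h2, h3, -⟩) hxc
    · exact C.light N.ne_ac'.symm fun h => N.nac' h.symm
    · exact C.light N.ne_bc'.symm fun h => N.nbc' h.symm
    · exact (hxc h).elim
    · have h := (N.simplicial_facts C.adj_trans h1 h2 h3).2.2.2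
      exact (C.light h.1 h.2).symm
  have light_a'b' : Light G a' b' := C.light N.ne_a'b' N.na'b'
  have light_a'c' : Light G a' c' := C.light N.ne_a'c' N.na'c'
  have light_b'c' : Light G b' c' := C.light N.ne_b'c' N.nb'c'
  have hinj : ∀ i j, i < j → j ≤ k → p i ≠ p j := fun i j h1 h2 => (hadj i j h1 h2).ne
  -- The induced path `a', a, …, b, b'` has at least five vertices since `2 ≤ k`, and its
  -- nonadjacent pairs are light. This excludes `P₅`; the net and `Z₂` need a further vertex
  -- attached to the path.
  let e : ℕ → V := extendPath a' p k b'
  have he : ∀ i ≤ k + 2, (i = 0 ∧ e i = a') ∨ (∃ j ≤ k, i = j + 1 ∧ e i = p j) ∨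
      (i = k + 2 ∧ e i = b') := fun i hi => extendPath_cases a' p k b' hi
  have hep : ∀ j ≤ k, e (j + 1) = p j := by
    intro j hj
    simp only [e, extendPath]
    rw [if_neg (by omega), if_pos (by omega), Nat.add_sub_cancel]
  have he0 : e 0 = a' := rfl
  have hek : e (k + 2) = b' := by
    simp only [e, extendPath]
    rw [if_neg (by omega), if_neg (by omega)]
  have headj : ∀ i < k + 2, G.Adj (e i) (e (i + 1)) := by
    intro i hi
    rcases he i hi.le with ⟨rfl, h⟩ | ⟨j, hj, rfl, h⟩ | ⟨rfl, h⟩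
    · rw [h, hep 0 (by omega), hp0]
      exact haa'.symm
    · rcases Nat.eq_or_lt_of_le hj with rfl | hj'
      · rw [h, hek, hpk]
        exact hbb'
      · rw [h, hep (j + 1) (by omega)]
        exact hp.adj j hj'
    · omega
  have hel : ∀ i j, i + 1 < j → j ≤ k + 2 → Light G (e i) (e j) := by
    intro i j hij hj
    rcases he i (by omega) with ⟨rfl, h⟩ | ⟨i, hi, rfl, h⟩ | ⟨rfl, h⟩
    · rw [h]
      rcases he j hj with ⟨rfl, h'⟩ | ⟨j, hj', rfl, h'⟩ | ⟨rfl, h'⟩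
      · omega
      · rw [h']
        refine light_a' _ (hcore j hj') fun h => ?_
        exact hinj 0 j (by omega) hj' (by rw [h, hp0])
      · rw [h']
        exact light_a'b'
    · rw [h]
      rcases he j hj with ⟨rfl, h'⟩ | ⟨j, hj', rfl, h'⟩ | ⟨rfl, h'⟩
      · omega
      · rw [h']
        exact core_light _ _ (hcore i hi) (hcore j hj') (hinj i j (by omega) hj')
          (hch i j (by omega) hj').2
      · rw [h']
        refine (light_b' _ (hcore i hi) fun h => ?_).symm
        exact hinj i k (by omega) le_rfl (by rw [h, hpk])
    · omega
  -- On a link from `c` to `a`, let `q = r j₀` be the first vertex with a neighbour on `p`. Its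
  -- predecessor, or `c'` if `q = c`, serves as `q'`.
  obtain ⟨r, l, hl, hr⟩ := (C.linked N.ac.symm).exists_isLink
  have hrin : ∀ j, 0 < j → j < l →
      r j ∈ simplicial G' ∧ G'.Adj (r j) a ∧ G'.Adj (r j) b := by
    intro j h1 h2
    have hs := hr.mem j h1 h2
    have h3 : G'.Adj (r j) a := by
      rw [← hr.last]
      refine (C.eq_or_adj_of_isLink hr h2 le_rfl).resolve_left fun h => ?_
      rw [hr.last] at h
      exact N.notMem_simplicial (h ▸ hs)
    have h4 : G'.Adj (r j) c := by
      rw [← hr.zero]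
      refine ((C.eq_or_adj_of_isLink hr h1 h2.le).resolve_left fun h => ?_).symm
      rw [hr.zero] at h
      exact N.rotate.rotate.notMem_simplicial (h ▸ hs)
    refine ⟨hs, h3, C.adj_trans h3.symm N.ac N.ab h4 N.bc.symm ?_⟩
    intro h
    exact N.rotate.notMem_simplicial (h ▸ hs)
  have hrcore : ∀ j < l, InCore G' a b c (r j) := by
    intro j hj
    rcases Nat.eq_zero_or_pos j with rfl | h
    · exact Or.inr (Or.inr (Or.inl hr.zero))
    · obtain ⟨h3, h4, h5⟩ := hrin j h hj
      exact core_of _ h3 h4 h5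
  have hcp : ∀ i ≤ k, p i ≠ c := by
    intro i hi h
    rcases hcases i hi with ⟨-, h'⟩ | ⟨-, h'⟩ | ⟨h1, h2⟩
    · exact N.ac.ne (h' ▸ h)
    · exact N.bc.ne (h' ▸ h)
    · exact N.rotate.rotate.notMem_simplicial (h ▸ (hin i h1 h2).1)
  have hex : ∃ j, j < l ∧ ∃ i ≤ k, G.Adj (r j) (p i) := by
    refine ⟨l - 1, by omega, 0, by omega, ?_⟩
    have := hr.adj (l - 1) (by omega)
    rwa [Nat.sub_add_cancel hl, hr.last, ← hp0] at this
  obtain ⟨hjl, i₀, hi₀, hqi₀⟩ := Nat.find_spec hex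
  have hmin : ∀ j < Nat.find hex, ∀ i ≤ k, ¬ G.Adj (r j) (p i) := fun j hj i hi h =>
    Nat.find_min hex hj ⟨by omega, i, hi, h⟩
  set j₀ := Nat.find hex with hj₀
  have hpnbr : ∀ i ≤ k, ∃ i' ≤ k, G.Adj (p i) (p i') := by
    intro i hi
    rcases Nat.eq_zero_or_pos i with rfl | h
    · exact ⟨1, by omega, hp.adj 0 (by omega)⟩
    · refine ⟨i - 1, by omega, ?_⟩
      have := hp.adj (i - 1) (by omega)
      rw [Nat.sub_add_cancel h] at this
      exact this.symm
  have hqp : ∀ i ≤ k, r j₀ ≠ p i := by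
    intro i hi h
    rcases Nat.eq_zero_or_pos j₀ with h0 | h0
    · rw [h0, hr.zero] at h
      exact hcp i hi h.symm
    · have := hr.adj (j₀ - 1) (by omega)
      rw [Nat.sub_add_cancel h0, h] at this
      exact hmin (j₀ - 1) (by omega) i hi this
  have hq0 : r j₀ ≠ a := hp0 ▸ hqp 0 (by omega)
  have hqk : r j₀ ≠ b := hpk ▸ hqp k le_rfl
  obtain ⟨q', hqq', hq'a', hq'b', hq'p⟩ : ∃ q', G.Adj (r j₀) q' ∧ Light G q' a' ∧ Light G q' b' ∧
      ∀ i ≤ k, Light G q' (p i) := by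
    rcases Nat.eq_zero_or_pos j₀ with h0 | h0
    · rw [h0, hr.zero]
      exact ⟨c', hcc', light_a'c'.symm, light_b'c'.symm,
        fun i hi => light_c' _ (hcore i hi) (hcp i hi)⟩
    · have hadj' := hr.adj (j₀ - 1) (by omega)
      rw [Nat.sub_add_cancel h0] at hadj'
      have hcore' := hrcore (j₀ - 1) (by omega)
      have hne : ∀ i ≤ k, r (j₀ - 1) ≠ p i := by
        intro i hi h
        obtain ⟨i', hi', h'⟩ := hpnbr i hi
        exact hmin (j₀ - 1) (by omega) i' hi' (h ▸ h')
      refine ⟨r (j₀ - 1), hadj'.symm, (light_a' _ hcore' ?_).symm, (light_b' _ hcore' ?_).symm,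
        fun i hi => core_light _ _ hcore' (hcore i hi) (hne i hi) (hmin _ (by omega) i hi)⟩
      · exact hp0 ▸ hne 0 (by omega)
      · exact hpk ▸ hne k le_rfl
  have hqcore := hrcore j₀ hjl
  obtain ⟨i, hi0, him, hqi, hqi', hql⟩ := exists_consecutive_neighbors (m := k + 2)
    C.false_of_claw headj hel hqq'
    (by
      intro i hi
      rcases he i hi with ⟨-, h⟩ | ⟨j, hj, -, h⟩ | ⟨-, h⟩
      · rwa [h]
      · rw [h]
        exact hq'p j hj
      · rwa [h])
    (by
      intro i hi
      rcases he i hi with ⟨-, h⟩ | ⟨j, hj, -, h⟩ | ⟨-, h⟩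
      · rw [h]
        exact Or.inr (light_a' _ hqcore hq0).symm
      · rw [h]
        by_cases hadj' : G.Adj (r j₀) (p j)
        · exact Or.inl hadj'
        · exact Or.inr (core_light _ _ hqcore (hcore j hj) (hqp j hj) hadj')
      · rw [h]
        exact Or.inr (light_b' _ hqcore hqk).symm)
    ((light_a' _ hqcore hq0).symm) (hek ▸ (light_b' _ hqcore hqk).symm)
    ⟨i₀ + 1, by omega, hep i₀ hi₀ ▸ hqi₀⟩
  have hq'e : ∀ i ≤ k + 2, Light G q' (e i) := by
    intro i hi
    rcases he i hi with ⟨-, h⟩ | ⟨j, hj, -, h⟩ | ⟨-, h⟩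
    · rwa [h]
    · rw [h]
      exact hq'p j hj
    · rwa [h]
  obtain ⟨i, rfl⟩ := Nat.exists_eq_succ_of_ne_zero hi0.ne'
  rcases hS with hS | hS | hS
  · exact false_of_light_net hS (headj (i + 1) (by omega)) hqi.symm hqi'.symm
      (headj i (by omega)).symm (headj (i + 2) (by omega)) hqq'
      (hel (i + 1) (i + 3) (by omega) (by omega)) (hq'e (i + 1) (by omega)).symm
      (hel i (i + 2) (by omega) (by omega)).symm (hq'e (i + 2) (by omega)).symm
      (hql i (by omega) (by omega) (by omega))
      (hql (i + 3) (by omega) (by omega) (by omega))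
      (hel i (i + 3) (by omega) (by omega)) (hq'e i (by omega)).symm
      (hq'e (i + 3) (by omega)).symm
  · exact false_of_light_P₅ hS (headj 0 (by omega)) (headj 1 (by omega)) (headj 2 (by omega))
      (headj 3 (by omega)) (hel 0 2 (by omega) (by omega)) (hel 0 3 (by omega) (by omega))
      (hel 0 4 (by omega) (by omega)) (hel 1 3 (by omega) (by omega))
      (hel 1 4 (by omega) (by omega)) (hel 2 4 (by omega) (by omega))
  -- The tail of `Z₂` needs two path vertices on one side of the triangle: towards `b'` if the
  -- triangle sits at the start, otherwise towards `a'`.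
  · by_cases hi : i = 0
    · subst hi
      exact false_of_light_Z₂ hS hqi hqi' (headj 1 (by omega)) (headj 2 (by omega))
        (headj 3 (by omega)) (hql 3 (by omega) (by omega) (by omega))
        (hql 4 (by omega) (by omega) (by omega)) (hel 1 3 (by omega) (by omega))
        (hel 1 4 (by omega) (by omega)) (hel 2 4 (by omega) (by omega))
    · obtain ⟨i, rfl⟩ := Nat.exists_eq_succ_of_ne_zero hi
      exact false_of_light_Z₂ hS hqi' hqi (headj (i + 2) (by omega)).symm
        (headj (i + 1) (by omega)).symm (headj i (by omega)).symm
        (hql (i + 1) (by omega) (by omega) (by omega))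
        (hql i (by omega) (by omega) (by omega))
        (hel (i + 1) (i + 3) (by omega) (by omega)).symm
        (hel i (i + 3) (by omega) (by omega)).symm (hel i (i + 2) (by omega) (by omega)).symm

end Triangle

/-! ### The cliques at the corners of a net -/

section Line

variable {V : Type*} {G : SimpleGraph V} {u v r s y a b c a' b' c' : V}

/-- The edge `u v` with the common neighbours of its ends. -/
def line (G : SimpleGraph V) (u v : V) : Set V := {y | y = u ∨ y = v ∨ (G.Adj y u ∧ G.Adj y v)}

theorem left_mem_line : u ∈ line G u v := Or.inl rfl

theorem right_mem_line : v ∈ line G u v := Or.inr (Or.inl rfl)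

theorem adj_of_mem_line
    (htr : ∀ {x p q r}, G.Adj x p → G.Adj x q → G.Adj x r → G.Adj p q → G.Adj q r →
      p ≠ r → G.Adj p r) (huv : G.Adj u v) (hr : r ∈ line G u v) (hs : s ∈ line G u v)
    (hrs : r ≠ s) : G.Adj r s := by
  rcases hr with rfl | rfl | ⟨hr1, hr2⟩ <;> rcases hs with rfl | rfl | ⟨hs1, hs2⟩
  · exact (hrs rfl).elim
  · exact huv
  · exact hs1.symm
  · exact huv.symm
  · exact (hrs rfl).elim
  · exact hs2.symm
  · exact hr1
  · exact hr2
  · exact htr hr1.symm huv hs1.symm hr2 hs2.symm hrs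

/-- In `N(r)` the vertex `y` is adjacent to `s`, and `s` to every other member of the line. Thus a
line is a maximal clique determined by any two of its vertices. -/
theorem mem_line_of_adj
    (htr : ∀ {x p q r}, G.Adj x p → G.Adj x q → G.Adj x r → G.Adj p q → G.Adj q r →
      p ≠ r → G.Adj p r) (huv : G.Adj u v) (hr : r ∈ line G u v) (hs : s ∈ line G u v)
    (hrs : r ≠ s) (hyr : G.Adj y r) (hys : G.Adj y s) : y ∈ line G u v := by
  have hadj := adj_of_mem_line htr huv hr hs hrs
  have key : ∀ w, w ∈ line G u v → y ≠ w → G.Adj y w := by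
    intro w hw hyw
    by_cases hwr : w = r
    · exact hwr ▸ hyr
    by_cases hws : w = s
    · exact hws ▸ hys
    exact htr hyr.symm hadj (adj_of_mem_line htr huv hr hw fun h => hwr h.symm) hys
      (adj_of_mem_line htr huv hs hw fun h => hws h.symm) hyw
  by_cases h1 : y = u
  · exact Or.inl h1
  by_cases h2 : y = v
  · exact Or.inr (Or.inl h2)
  exact Or.inr (Or.inr ⟨key u left_mem_line h1, key v right_mem_line h2⟩)

theorem IsNet.notMem_line (N : IsNet G a b c a' b' c')
    (htr : ∀ {x p q r}, G.Adj x p → G.Adj x q → G.Adj x r → G.Adj p q → G.Adj q r →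
      p ≠ r → G.Adj p r) (hy : y ∈ line G b b') (hyb : y ≠ b) :
    G.Adj y b ∧ (y ≠ a ∧ ¬ G.Adj y a) ∧ (y ≠ c ∧ ¬ G.Adj y c) := by
  have h : ∀ x, G.Adj b x → x ≠ b' → ¬ G.Adj x b' → y ≠ x ∧ ¬ G.Adj y x := by
    intro x hx hxb hxb'
    rcases hy with rfl | rfl | ⟨h1, h2⟩
    · exact (hyb rfl).elim
    · exact ⟨hxb.symm, fun h => hxb' h.symm⟩
    · refine ⟨?_, fun h => ?_⟩
      · rintro rfl
        exact hxb' h2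
      · exact hxb' (htr hx h1.symm N.bb' h.symm h2 hxb)
  exact ⟨adj_of_mem_line htr N.bb' hy left_mem_line hyb, h a N.ab.symm N.ne_ab' N.nab',
    h c N.bc N.ne_cb' N.ncb'⟩

theorem IsNet.disjoint_line (N : IsNet G a b c a' b' c')
    (htr : ∀ {x p q r}, G.Adj x p → G.Adj x q → G.Adj x r → G.Adj p q → G.Adj q r →
      p ≠ r → G.Adj p r) (ha : y ∈ line G a a') (hb : y ∈ line G b b') : False := by
  by_cases hyb : y = b
  · subst hyb
    exact (N.swap.notMem_line htr ha N.ab.ne').2.1.1 rfl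
  · have h := N.notMem_line htr hb hyb
    exact (N.swap.notMem_line htr ha h.2.1.1).2.1.2 h.1

end Line

section Corner

variable {V : Type*} [Fintype V] {G G' : SimpleGraph V} {a b c a' b' c' y f : V}

/-- At most one of the cliques at the corners of a net contains a pair with a large
degree sum. -/
theorem IsNet.not_large_of_large (C : ClosedOver G G') (N : IsNet G' a b c a' b' c')
    {p q r s : V} (hp : p ∈ line G' a a') (hq : q ∈ line G' a a') (hpq : p ≠ q)
    (hr : r ∈ line G' b b') (hs : s ∈ line G' b b') (hrs : r ≠ s)
    (hL : LargeDegreeSum G' p q) : ¬ LargeDegreeSum G' r s := by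
  intro hL'
  have hne : ∀ x ∈ line G' a a', ∀ z ∈ line G' b b', x ≠ z := by
    rintro x hx z hz rfl
    exact N.disjoint_line C.adj_trans hx hz
  have hadj : ∀ x ∈ line G' a a', ∀ z ∈ line G' b b', LargeDegreeSum G' x z → G'.Adj x z :=
    fun x hx z hz h => by_contra fun h' => C.not_large (hne x hx z hz) h' h
  have h1 : ∀ x ∈ line G' a a', G'.Adj x r → ¬ G'.Adj x s := fun x hx h1 h2 =>
    hne x hx x (mem_line_of_adj C.adj_trans N.bb' hr hs hrs h1 h2) rfl
  have h2 : ∀ z ∈ line G' b b', G'.Adj p z → ¬ G'.Adj q z := fun z hz h1 h2 =>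
    hne z (mem_line_of_adj C.adj_trans N.aa' hp hq hpq h1.symm h2.symm) z hz rfl
  -- The four degrees sum to at least `2n`, so each way of matching `p, q` with `r, s` contains a
  -- large pair, which must be adjacent. Two such edges from different matchings share an end, and
  -- that vertex would lie in both cliques.
  have h3 : G'.Adj p r ∨ G'.Adj q s := by
    by_contra! h
    have h3 : ¬ LargeDegreeSum G' p r := fun h' => h.1 (hadj p hp r hr h')
    have h4 : ¬ LargeDegreeSum G' q s := fun h' => h.2 (hadj q hq s hs h')
    rw [largeDegreeSum_iff] at *
    omega
  have h4 : G'.Adj p s ∨ G'.Adj q r := by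
    by_contra! h
    have h3 : ¬ LargeDegreeSum G' p s := fun h' => h.1 (hadj p hp s hs h')
    have h4 : ¬ LargeDegreeSum G' q r := fun h' => h.2 (hadj q hq r hr h')
    rw [largeDegreeSum_iff] at *
    omega
  rcases h3 with h3 | h3 <;> rcases h4 with h4 | h4
  · exact h1 p hp h3 h4
  · exact h2 r hr h3 h4
  · exact h2 s hs h4 h3
  · exact h1 q hq h4 h3

/-- By 2-connectedness the clique at a corner has an outgoing edge that avoids the corner. -/
theorem IsNet.exists_exit (C : ClosedOver G G') (N : IsNet G' a b c a' b' c')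
    (hconn : (G.induce {b}ᶜ).Connected) :
    ∃ y f, y ∈ line G' b b' ∧ y ≠ b ∧ f ≠ b ∧ ¬ G'.Adj f b ∧ G.Adj y f := by
  obtain ⟨w⟩ := hconn.preconnected ⟨b', N.bb'.ne'⟩ ⟨a, N.ab.ne⟩
  obtain ⟨d, -, h1, h2⟩ := w.exists_boundary_dart {z | (z : V) ∈ line G' b b'} right_mem_line
    fun h => (N.notMem_line C.adj_trans h N.ab.ne).2.1.1 rfl
  have hd : G.Adj (d.fst : V) (d.snd : V) := d.adj
  exact ⟨d.fst, d.snd, h1, d.fst.2, d.snd.2, fun h => h2 (mem_line_of_adj C.adj_trans N.bb' h1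
    left_mem_line d.fst.2 (C.le hd).symm h), hd⟩

/-! ### Forbidding `P₅` -/

/-- The path is `f y b c c'` if `b y` is an edge of `G`. Otherwise it is `z x b c c'`, where `b x z`
starts a shortest link to `y`; the pair `b, z` is light because the clique has no large pair. -/
theorem ClosedOver.false_of_exit_P₅ (C : ClosedOver G G')
    (hS : OHeavy (SimpleGraph.pathGraph 5) G) (N : IsNet G' a b c a' b' c') (hbc : G.Adj b c)
    (hcc' : G.Adj c c')
    (hB : ∀ p ∈ line G' b b', ∀ q ∈ line G' b b', p ≠ q → ¬ LargeDegreeSum G' p q)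
    (hy : y ∈ line G' b b') (hyb : y ≠ b) (hyf : G.Adj y f) (hfb : f ≠ b) (hfb' : ¬ G'.Adj f b)
    (hyc' : ¬ G'.Adj y c') (hfc : ¬ G'.Adj f c) (hfc' : ¬ G'.Adj f c') : False := by
  obtain ⟨h1, -, hyc, hyc2⟩ := N.notMem_line C.adj_trans hy hyb
  have hy_c' : y ≠ c' := by
    rintro rfl
    exact N.nbc' h1.symm
  have hf_c : f ≠ c := by
    rintro rfl
    exact hyc2 (C.le hyf)
  have hf_c' : f ≠ c' := by
    rintro rfl
    exact hyc' (C.le hyf)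
  have lbc' := C.light N.ne_bc' N.nbc'
  by_cases hby : G.Adj b y
  · exact false_of_light_P₅ hS hyf.symm hby.symm hbc hcc' (C.light hfb hfb') (C.light hf_c hfc)
      (C.light hf_c' hfc') (C.light hyc hyc2) (C.light hy_c' hyc') lbc'
  · obtain ⟨x, z, hbx, hxz, hbz, hbz', ⟨hxs, hxy⟩, hz, hbz2⟩ := C.exists_two_steps h1.symm hby
    have hs : ∀ x, x ∈ simplicial G' → G'.Adj x y → G'.Adj x b →
        x ∈ line G' b b' ∧ x ≠ b ∧ x ≠ c' ∧ ¬ G'.Adj x c' := by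
      intro x hx h2 h3
      refine ⟨mem_line_of_adj C.adj_trans N.bb' hy left_mem_line hyb h2 h3, h3.ne, ?_,
        fun h => N.nbc' (hx h3 h N.ne_bc')⟩
      rintro rfl
      exact N.nbc' h3.symm
    have hx' := hs x hxs hxy (C.le hbx).symm
    have hz' : z ∈ line G' b b' ∧ z ≠ b ∧ z ≠ c' ∧ ¬ G'.Adj z c' := by
      rcases hz with rfl | ⟨hzs, hzy⟩
      · exact ⟨hy, hyb, hy_c', hyc'⟩
      · exact hs z hzs hzy hbz2.symm
    have hxc := (N.notMem_line C.adj_trans hx'.1 hx'.2.1).2.2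
    have hzc := (N.notMem_line C.adj_trans hz'.1 hz'.2.1).2.2
    refine false_of_light_P₅ hS hxz.symm hbx.symm hbc hcc'
      ⟨hbz.symm, fun h => hbz' h.symm, fun h => ?_⟩ (C.light hzc.1 hzc.2)
      (C.light hz'.2.2.1 hz'.2.2.2) (C.light hxc.1 hxc.2) (C.light hx'.2.2.1 hx'.2.2.2) lbc'
    exact hB z hz'.1 b left_mem_line hbz.symm (h.mono C.le)

theorem ClosedOver.not_adj_both (C : ClosedOver G G') (N : IsNet G' a b c a' b' c')
    (hy : y ∈ line G' b b') (hyb : y ≠ b) (hya' : G'.Adj y a') : ¬ G'.Adj y c' := fun hyc' =>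
  N.na'c' (C.claw_free (N.notMem_line C.adj_trans hy hyb).1 hya' hyc' N.ne_ba' N.ne_bc' N.ne_a'c'
    N.nba' N.nbc')

theorem ClosedOver.false_of_adj_P₅ (C : ClosedOver G G')
    (hS : OHeavy (SimpleGraph.pathGraph 5) G) (N : IsNet G' a b c a' b' c') (hbc : G.Adj b c)
    (hcc' : G.Adj c c')
    (hB : ∀ p ∈ line G' b b', ∀ q ∈ line G' b b', p ≠ q → ¬ LargeDegreeSum G' p q)
    (hy : y ∈ line G' b b') (hyb : y ≠ b) (hya' : G'.Adj y a') : False := by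
  have hyc' := C.not_adj_both N hy hyb hya'
  obtain ⟨h1, -, hyc, hyc2⟩ := N.notMem_line C.adj_trans hy hyb
  have hy_c' : y ≠ c' := by
    rintro rfl
    exact N.nbc' h1.symm
  obtain ⟨f, hyf, rfl | ⟨hs, hfa'⟩⟩ := C.exists_adj hya'
  · exact C.false_of_exit_P₅ hS N hbc hcc' hB hy hyb hyf N.ne_ba'.symm (fun h => N.nba' h.symm)
      hyc' (fun h => N.nca' h.symm) N.na'c'
  · have hfy := (C.le hyf).symm
    refine C.false_of_exit_P₅ hS N hbc hcc' hB hy hyb hyf ?_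
      (fun h => N.nba' (hs h hfa' N.ne_ba')) hyc' (fun h => hyc2 (hs hfy h hyc))
      (fun h => hyc' (hs hfy h hy_c'))
    rintro rfl
    exact N.nba' hfa'

theorem ClosedOver.false_of_P₅ (C : ClosedOver G G')
    (hS : OHeavy (SimpleGraph.pathGraph 5) G) (N : IsNet G' a b c a' b' c')
    (hab : G.Adj a b) (hbc : G.Adj b c) (haa' : G.Adj a a') (hcc' : G.Adj c c')
    (hB : ∀ p ∈ line G' b b', ∀ q ∈ line G' b b', p ≠ q → ¬ LargeDegreeSum G' p q)
    (hconn : (G.induce {b}ᶜ).Connected) : False := by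
  obtain ⟨y, f, hy, hyb, hfb, hfb', hyf⟩ := N.exists_exit C hconn
  by_cases hya' : G'.Adj y a'
  · exact C.false_of_adj_P₅ hS N hbc hcc' hB hy hyb hya'
  by_cases hyc' : G'.Adj y c'
  · exact C.false_of_adj_P₅ hS N.rotate.swap hab.symm haa' hB hy hyb hyc'
  obtain ⟨h1, ⟨hya, hya2⟩, hyc, hyc2⟩ := N.notMem_line C.adj_trans hy hyb
  have hyf' := C.le hyf
  have hne : ∀ {x}, ¬ G'.Adj y x → f ≠ x := by
    rintro x hx rfl
    exact hx hyf'
  have hclaw : ∀ {u v}, G'.Adj f u → G'.Adj f v → y ≠ u → y ≠ v → u ≠ v → ¬ G'.Adj y u →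
      ¬ G'.Adj y v → G'.Adj u v := fun hu hv h2 h3 h4 h5 h6 =>
    C.claw_free hyf'.symm hu hv h2 h3 h4 h5 h6
  have hy_a' : y ≠ a' := by
    rintro rfl
    exact N.nba' h1.symm
  have hy_c' : y ≠ c' := by
    rintro rfl
    exact N.nbc' h1.symm
  by_cases hA : ¬ G'.Adj f a ∧ ¬ G'.Adj f a'
  · exact C.false_of_exit_P₅ hS N.rotate.swap hab.symm haa' hB hy hyb hyf hfb hfb' hya' hA.1 hA.2
  by_cases hC : ¬ G'.Adj f c ∧ ¬ G'.Adj f c'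
  · exact C.false_of_exit_P₅ hS N hbc hcc' hB hy hyb hyf hfb hfb' hyc' hC.1 hC.2
  -- Now `f` meets both `{a, a'}` and `{c, c'}`. Neighbours `a` and `c` force `b` as well; any other
  -- choice gives a claw at `f` with the leaf `y`.
  rw [not_and_or, not_not, not_not] at hA hC
  rcases hA with hA | hA <;> rcases hC with hC | hC
  · exact hfb' (C.adj_trans hA.symm N.ac N.ab hC N.bc.symm hfb)
  · exact N.nac' (hclaw hA hC hya hy_c' N.ne_ac' hya2 hyc')
  · exact N.nca' (hclaw hC hA hyc hy_a' N.ne_ca' hyc2 hya')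
  · exact N.na'c' (hclaw hA hC hy_a' hy_c' N.ne_a'c' hya' hyc')

end Corner

/-! ### Forbidding `Z₂` -/

section CornerZ₂

variable {V : Type*} [Fintype V] {G G' : SimpleGraph V} {a b c a' b' c' y z f : V}

namespace ClosedOver

/-- Otherwise the first two steps of a shortest link from `b` to `y`, hung on the triangle `a c b`,
form a light `Z₂`. -/
theorem adj_corner (C : ClosedOver G G') (hS : OHeavy Z₂ G) (N : IsNet G' a b c a' b' c')
    (hab : G.Adj a b) (hbc : G.Adj b c) (hac : G.Adj a c)
    (hB : ∀ p ∈ line G' b b', ∀ q ∈ line G' b b', p ≠ q → ¬ LargeDegreeSum G' p q)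
    (hy : y ∈ line G' b b') (hyb : y ≠ b) : G.Adj b y := by
  by_contra hby
  have h1 := (N.notMem_line C.adj_trans hy hyb).1
  obtain ⟨x, z, hbx, hxz, hbz, hbz', ⟨hxs, hxy⟩, hz, hbz2⟩ := C.exists_two_steps h1.symm hby
  have hx' : x ∈ line G' b b' :=
    mem_line_of_adj C.adj_trans N.bb' hy left_mem_line hyb hxy (C.le hbx).symm
  have hz' : z ∈ line G' b b' := by
    rcases hz with rfl | ⟨-, hzy⟩
    · exact hy
    · exact mem_line_of_adj C.adj_trans N.bb' hy left_mem_line hyb hzy hbz2.symm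
  obtain ⟨-, hxa, hxc⟩ := N.notMem_line C.adj_trans hx' hbx.ne'
  obtain ⟨-, hza, hzc⟩ := N.notMem_line C.adj_trans hz' hbz.symm
  exact false_of_light_Z₂ hS hac hab hbc.symm hbx hxz (C.light hxa.1 hxa.2).symm
    (C.light hza.1 hza.2).symm (C.light hxc.1 hxc.2).symm (C.light hzc.1 hzc.2).symm
    ⟨hbz, hbz', fun h => hB b left_mem_line z hz' hbz (h.mono C.le)⟩

/-- Otherwise `b` is the centre of a light claw with leaves `y`, `z`, `a`. -/
theorem adj_of_corner (C : ClosedOver G G') (hS : OHeavy Z₂ G) (N : IsNet G' a b c a' b' c')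
    (hab : G.Adj a b) (hbc : G.Adj b c) (hac : G.Adj a c)
    (hB : ∀ p ∈ line G' b b', ∀ q ∈ line G' b b', p ≠ q → ¬ LargeDegreeSum G' p q)
    (hy : y ∈ line G' b b') (hyb : y ≠ b) (hz : z ∈ line G' b b') (hzb : z ≠ b) (hyz : y ≠ z) :
    G.Adj y z := by
  by_contra h
  obtain ⟨-, hya, -⟩ := N.notMem_line C.adj_trans hy hyb
  obtain ⟨-, hza, -⟩ := N.notMem_line C.adj_trans hz hzb
  exact C.false_of_claw (C.adj_corner hS N hab hbc hac hB hy hyb)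
    (C.adj_corner hS N hab hbc hac hB hz hzb) hab.symm
    ⟨hyz, h, fun hL => hB y hy z hz hyz (hL.mono C.le)⟩ (C.light hya.1 hya.2)
    (C.light hza.1 hza.2)

theorem false_of_adj_Z₂ (C : ClosedOver G G') (hS : OHeavy Z₂ G) (N : IsNet G' a b c a' b' c')
    (hab : G.Adj a b) (hbc : G.Adj b c) (hac : G.Adj a c) (hcc' : G.Adj c c')
    (hB : ∀ p ∈ line G' b b', ∀ q ∈ line G' b b', p ≠ q → ¬ LargeDegreeSum G' p q)
    (hy : y ∈ line G' b b') (hyb : y ≠ b) (hya' : G'.Adj y a') : False := by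
  have hyc' := C.not_adj_both N hy hyb hya'
  obtain ⟨h1, -, hyc⟩ := N.notMem_line C.adj_trans hy hyb
  have hy_c' : y ≠ c' := by
    rintro rfl
    exact N.nbc' h1.symm
  have hb'y : b' ≠ y := by
    rintro rfl
    exact N.na'b' hya'.symm
  exact false_of_light_Z₂ hS
    (C.adj_of_corner hS N hab hbc hac hB right_mem_line N.bb'.ne' hy hyb hb'y)
    (C.adj_corner hS N hab hbc hac hB right_mem_line N.bb'.ne').symm
    (C.adj_corner hS N hab hbc hac hB hy hyb).symm hbc hcc'
    (C.light N.ne_cb' N.ncb').symm (C.light N.ne_b'c' N.nb'c') (C.light hyc.1 hyc.2)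
    (C.light hy_c' hyc') (C.light N.ne_bc' N.nbc')

/-- A net of `G` in which a neighbour of `b'` lies in the clique of the edge `a a'`. -/
theorem false_of_exit_Z₂ (C : ClosedOver G G') (hS : OHeavy Z₂ G)
    (N : IsNet G' a b c a' b' c') (hab : G.Adj a b) (hbc : G.Adj b c) (hac : G.Adj a c)
    (haa' : G.Adj a a') (hbb' : G.Adj b b') (hcc' : G.Adj c c') (hf : G.Adj b' f)
    (hfb : f ≠ b) (hfb' : ¬ G'.Adj f b) (hfa : G'.Adj f a) : False := by
  have hf' := C.le hf
  have hf_a' : f ≠ a' := by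
    rintro rfl
    exact N.na'b' hf'.symm
  have hfA : f ∈ line G' a a' := Or.inr (Or.inr ⟨hfa, by_contra fun h =>
    N.nba' (C.claw_free hfa.symm N.aa' N.ab hf_a' hfb N.ne_ba'.symm h hfb').symm⟩)
  have hfa' : G'.Adj f a' := adj_of_mem_line C.adj_trans N.aa' hfA right_mem_line hf_a'
  have hA : ∀ x ∈ line G' a a', x ≠ a → Light G x b ∧ Light G x c := by
    intro x hx hxa
    obtain ⟨-, h1, h2⟩ := N.swap.notMem_line C.adj_trans hx hxa
    exact ⟨C.light h1.1 h1.2, C.light h2.1 h2.2⟩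
  have hAb' : ∀ x ∈ line G' a a', x ≠ f → Light G x b' := by
    intro x hx hxf
    refine C.light ?_ fun h => ?_
    · rintro rfl
      exact N.disjoint_line C.adj_trans hx right_mem_line
    · exact N.disjoint_line C.adj_trans
        (mem_line_of_adj C.adj_trans N.aa' hx hfA hxf h.symm hf') right_mem_line
  have hmem : ∀ {r s x}, r ∈ line G' a a' → s ∈ line G' a a' → r ≠ s → G.Adj r x → G.Adj s x →
      x ∈ line G' a a' := fun hr hs hrs h1 h2 =>
    mem_line_of_adj C.adj_trans N.aa' hr hs hrs (C.le h1).symm (C.le h2).symm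
  have haA : a ∈ line G' a a' := left_mem_line
  have ha'A : a' ∈ line G' a a' := right_mem_line
  have hfc' : Light G f c' := by
    refine C.light ?_ (C.not_adj_both N.swap hfA hfa.ne hf'.symm)
    rintro rfl
    exact N.nac' hfa.symm
  -- A triangle at `a` would carry the tail `b, b'`, and one at `f` the tail `b', b`. These two
  -- facts make the neighbourhoods below disjoint.
  have tri_a : ∀ p ∈ line G' a a', ∀ y ∈ line G' a a', p ≠ f → y ≠ f → G.Adj a p → G.Adj a y →
      ¬ G.Adj p y := by
    intro p hp y hy hpf hyf hap hay hpy
    exact false_of_light_Z₂ hS hpy hap.symm hay.symm hab hbb' (hA p hp hap.ne').1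
      (hAb' p hp hpf) (hA y hy hay.ne').1 (hAb' y hy hyf) (C.light N.ne_ab' N.nab')
  have tri_f : ∀ p ∈ line G' a a', ∀ y ∈ line G' a a', p ≠ a → y ≠ a → G.Adj f p → G.Adj f y →
      ¬ G.Adj p y := by
    intro p hp y hy hpa hya hfp hfy hpy
    exact false_of_light_Z₂ hS hpy hfp.symm hfy.symm hf.symm hbb'.symm (hAb' p hp hfp.ne')
      (hA p hp hpa).1 (hAb' y hy hfy.ne') (hA y hy hya).1 (C.light hfb hfb')
  by_cases haf : G.Adj a f
  · have hdis : ∀ y, G.Adj a y → ¬ G.Adj a' y := by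
      intro y hay ha'y
      have hyA := hmem haA ha'A N.aa'.ne hay ha'y
      by_cases hyf : y = f
      · subst hyf
        exact false_of_light_Z₂ hS ha'y.symm haf.symm haa'.symm hac hcc' (hA y hyA hfa.ne).2
          hfc' (hA a' ha'A N.aa'.ne').2 (C.light N.ne_a'c' N.na'c') (C.light N.ne_ac' N.nac')
      · exact tri_a a' ha'A y hyA hf_a'.symm hyf haa' hay ha'y
    have hLa'f : LargeDegreeSum G a' f := by
      by_contra hL
      exact C.false_of_claw haa' haf hab ⟨hf_a'.symm, hdis f haf, hL⟩
        (hA a' ha'A N.aa'.ne').1 (hA f hfA hfa.ne).1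
    obtain ⟨t, hta, ha't, hft⟩ := OHeavyPair.exists_common_ne
      ⟨hf_a'.symm, hdis f haf, hLa'f⟩ a
    have htA := hmem ha'A hfA hf_a'.symm ha't hft
    have hat : ¬ G.Adj a t := fun h => hdis t h ha't
    have hLat : LargeDegreeSum G a t := by
      by_contra hL
      exact false_of_light_Z₂ hS hbc hab.symm hac.symm haa' ha't (hA a' ha'A N.aa'.ne').1.symm
        (hA t htA hta).1.symm (hA a' ha'A N.aa'.ne').2.symm (hA t htA hta).2.symm
        ⟨hta.symm, hat, hL⟩
    have h1 := ncard_add_ncard_lt_of_disjoint hdis (w := b') (fun h => N.nab' (C.le h))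
      (fun h => N.na'b' (C.le h))
    have h2 := ncard_add_ncard_le_of_disjoint (G := G) (u := f) (v := t) fun y hfy hty => by
      have hyA := hmem hfA htA hft.ne hfy hty
      refine tri_f t htA y hyA hta ?_ hft hfy hty
      -- Here the vertex would be `a`, which is not adjacent to `t`.
      rintro rfl
      exact hat hty.symm
    -- The large pairs `a', f` and `a, t` give a total degree of at least `2n`, whereas the disjoint
    -- pairs `a, a'` (both missing `b'`) and `f, t` give less.
    rw [largeDegreeSum_iff] at hLa'f hLat
    omega
  · have hLaf : LargeDegreeSum G a f := by
      by_contra hL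
      exact false_of_light_Z₂ hS hac hab hbc.symm hbb' hf (C.light N.ne_ab' N.nab')
        ⟨hfa.ne', haf, hL⟩ (C.light N.ne_cb' N.ncb') (hA f hfA hfa.ne).2.symm
        (C.light hfb hfb').symm
    have hpair : OHeavyPair G a f := ⟨hfa.ne', haf, hLaf⟩
    obtain ⟨p, -, hap, hfp⟩ := hpair.exists_common_ne a
    obtain ⟨q, hqp, haq, hfq⟩ := hpair.exists_common_ne p
    have hpA := hmem haA hfA hfa.ne' hap hfp
    have hqA := hmem haA hfA hfa.ne' haq hfq
    have hLpq : LargeDegreeSum G p q := by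
      by_contra hL
      exact C.false_of_claw hap haq hab
        ⟨hqp.symm, tri_a p hpA q hqA hfp.ne' hfq.ne' hap haq, hL⟩
        (hA p hpA hap.ne').1 (hA q hqA haq.ne').1
    have h1 := ncard_add_ncard_lt_of_disjoint (G := G) (u := a) (v := p) (w := b')
      (fun y hay hpy => by
        have hyA := hmem haA hpA hap.ne hay hpy
        refine tri_a p hpA y hyA hfp.ne' ?_ hap hay hpy
        rintro rfl
        exact haf hay)
      (fun h => N.nab' (C.le h)) (hAb' p hpA hfp.ne').2.1
    have h2 := ncard_add_ncard_le_of_disjoint (G := G) (u := f) (v := q) fun y hfy hqy => by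
      have hyA := hmem hfA hqA hfq.ne hfy hqy
      refine tri_f q hqA y hyA haq.ne' ?_ hfq hfy hqy
      rintro rfl
      exact haf hfy.symm
    -- The same count for the large pairs `a, f` and `p, q` against the disjoint pairs `a, p` and
    -- `f, q`.
    rw [largeDegreeSum_iff] at hLaf hLpq
    omega

theorem false_of_Z₂ (C : ClosedOver G G') (hS : OHeavy Z₂ G) (N : IsNet G' a b c a' b' c')
    (hab : G.Adj a b) (hbc : G.Adj b c) (hac : G.Adj a c) (haa' : G.Adj a a')
    (hcc' : G.Adj c c')
    (hB : ∀ p ∈ line G' b b', ∀ q ∈ line G' b b', p ≠ q → ¬ LargeDegreeSum G' p q)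
    (hconn : (G.induce {b}ᶜ).Connected) : False := by
  obtain ⟨y, f, hy, hyb, hfb, hfb', hyf⟩ := N.exists_exit C hconn
  by_cases hya' : G'.Adj y a'
  · exact C.false_of_adj_Z₂ hS N hab hbc hac hcc' hB hy hyb hya'
  by_cases hyc' : G'.Adj y c'
  · exact C.false_of_adj_Z₂ hS N.rotate.swap hbc.symm hab.symm hac.symm haa' hB hy hyb hyc'
  obtain ⟨h1, ⟨-, hya⟩, -, hyc⟩ := N.notMem_line C.adj_trans hy hyb
  have hby := C.adj_corner hS N hab hbc hac hB hy hyb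
  -- The exit vertex `y` takes over the role of `b'`. If `f` misses `a` and `c`, then `y, f` is a
  -- tail on the triangle.
  have N' : IsNet G' a b c a' y c' := ⟨N.ab, N.bc, N.ac, N.aa', h1.symm, N.cc',
    fun h => hya h.symm, N.nac', N.nba', N.nbc', N.nca', fun h => hyc h.symm,
    fun h => hya' h.symm, N.na'c', hyc'⟩
  by_cases hfa : G'.Adj f a
  · exact C.false_of_exit_Z₂ hS N' hab hbc hac haa' hby hcc' hyf hfb hfb' hfa
  by_cases hfc : G'.Adj f c
  · exact C.false_of_exit_Z₂ hS N'.rotate.swap hbc.symm hab.symm hac.symm hcc' hby haa' hyf hfb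
      hfb' hfc
  have hf_a : a ≠ f := by
    rintro rfl
    exact hya (C.le hyf)
  have hf_c : c ≠ f := by
    rintro rfl
    exact hyc (C.le hyf)
  exact false_of_light_Z₂ hS hac hab hbc.symm hby hyf (C.light N'.ne_ab' N'.nab')
    (C.light hf_a fun h => hfa h.symm) (C.light N'.ne_cb' N'.ncb')
    (C.light hf_c fun h => hfc h.symm) (C.light hfb hfb').symm

end ClosedOver

/-! ### Nets in the closure of a 2-connected graph -/

theorem IsNet.exists_large (C : ClosedOver G G') (N : IsNet G' a b c a' b' c')
    (hconn : ∀ v, (G.induce {v}ᶜ).Connected)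
    (hS : OHeavy net G ∨ OHeavy (SimpleGraph.pathGraph 5) G ∨ OHeavy Z₂ G) :
    LargeDegreeSum G' a b ∨ LargeDegreeSum G' b c ∨ LargeDegreeSum G' a c := by
  by_contra! hL
  obtain ⟨lab, lbc, lac⟩ := hL
  obtain ⟨a', haa', N⟩ := N.exists_pendant C
  obtain ⟨b', hbb', N⟩ := N.rotate.exists_pendant C
  obtain ⟨c', hcc', N⟩ := N.rotate.exists_pendant C
  replace N := N.rotate
  have lba := fun h : LargeDegreeSum G' b a => lab h.symm
  have lcb := fun h : LargeDegreeSum G' c b => lbc h.symm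
  have lca := fun h : LargeDegreeSum G' c a => lac h.symm
  have hab := N.adj_of_not_large C haa' hbb' hcc' lab lbc lac hS
  have hbc := N.rotate.adj_of_not_large C hbb' hcc' haa' lbc lca lba hS
  have hac := (N.rotate.rotate.adj_of_not_large C hcc' haa' hbb' lca lab lcb hS).symm
  rcases hS with hS | hS
  · exact false_of_light_net hS hab hac hbc haa' hbb' hcc' (C.light N.ne_ab' N.nab')
      (C.light N.ne_ac' N.nac') (C.light N.ne_ba' N.nba') (C.light N.ne_bc' N.nbc')
      (C.light N.ne_ca' N.nca') (C.light N.ne_cb' N.ncb') (C.light N.ne_a'b' N.na'b')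
      (C.light N.ne_a'c' N.na'c') (C.light N.ne_b'c' N.nb'c')
  -- If the clique at `b` has a large pair, then the clique at `a` has none, and `a` and `b` change
  -- roles.
  by_cases hB : ∀ p ∈ line G' b b', ∀ q ∈ line G' b b', p ≠ q → ¬ LargeDegreeSum G' p q
  · rcases hS with hS | hS
    · exact C.false_of_P₅ hS N hab hbc haa' hcc' hB (hconn b)
    · exact C.false_of_Z₂ hS N hab hbc hac haa' hcc' hB (hconn b)
  · push Not at hB
    obtain ⟨r, hr, s, hs, hrs, hrs'⟩ := hB
    have hA : ∀ p ∈ line G' a a', ∀ q ∈ line G' a a', p ≠ q → ¬ LargeDegreeSum G' p q :=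
      fun p hp q hq hpq h => N.not_large_of_large C hp hq hpq hr hs hrs h hrs'
    rcases hS with hS | hS
    · exact C.false_of_P₅ hS N.swap hab.symm hac hbb' hcc' hA (hconn a)
    · exact C.false_of_Z₂ hS N.swap hab.symm hac hbc hbb' hcc' hA (hconn a)

theorem ClosedOver.nPHeavy (C : ClosedOver G G') (hconn : ∀ v, (G.induce {v}ᶜ).Connected)
    (hS : OHeavy net G ∨ OHeavy (SimpleGraph.pathGraph 5) G ∨ OHeavy Z₂ G) : NPHeavy G' := by
  intro g
  have N := isNet_of_embedding g
  rcases N.exists_large C hconn hS with h | h | h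
  · exact ⟨0, by simp, 1, by simp, N.ab, h⟩
  · exact ⟨1, by simp, 2, by simp, N.bc, h⟩
  · exact ⟨0, by simp, 2, by simp, N.ac, h⟩

end CornerZ₂

end CClosure

theorem mainTheorem6 {V : Type*} [Fintype V] (G : SimpleGraph V)
    (hconn : CClosure.IsTwoConnected G)
    (hclaw : CClosure.OHeavy CClosure.claw G)
    (hS : CClosure.OHeavy (SimpleGraph.pathGraph 4) G ∨
      CClosure.OHeavy (SimpleGraph.pathGraph 5) G ∨
      CClosure.OHeavy (SimpleGraph.cycleGraph 3) G ∨
      CClosure.OHeavy CClosure.Z₁ G ∨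
      CClosure.OHeavy CClosure.Z₂ G ∨
      CClosure.OHeavy CClosure.bull G ∨
      CClosure.OHeavy CClosure.net G)
    (G' : SimpleGraph V) (hG' : CClosure.IsCClosure G G') :
    CClosure.ClawFree G' ∧ CClosure.NPHeavy G' := by
  have C := hG'.closedOver hclaw
  refine ⟨C.clawFree, C.nPHeavy hconn.2.2 ?_⟩
  rcases hS with h | h | h | h | h | h | h
  · exact Or.inl (h.of_embedding CClosure.pathGraph_four_embedding_net.some)
  · exact Or.inr (Or.inl h)
  · exact Or.inl (h.of_embedding CClosure.cycleGraph_three_embedding_net.some)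
  · exact Or.inl (h.of_embedding CClosure.Z₁_embedding_net.some)
  · exact Or.inr (Or.inr h)
  · exact Or.inl (h.of_embedding CClosure.bull_embedding_net.some)
  · exact Or.inl h
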